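/- **Setting.** For every $n\ge 1$ let $P=P_n\in[0,1]^{n\times n}$ be a symmetric (deterministic) matrix, and let $A=A_n\in\{0,1\}^{n\times n}$ be the adjacency matrix of the inhomogeneous Erdős–Rényi random graph with edge probability matrix $P_n$: $A$ is a random symmetric matrix, the entries $A_{ij}$, $i\le j$, are independent, and $A_{ij}\sim\mathrm{Bernoulli}(P_{ij})$ (diagonal entries included). Let $\Delta=\Delta(n):=\max_i\sum_j P_{ij}$ be the maximum expected degree. Fix an integer $d\ge 0$. For $n\ge d+1$ let $0\le\hat\sigma_0\le\hat\sigma_1\le\dots\le\hat\sigma_d$ and $0\le\sigma_0\le\sigma_1\le\dots\le\sigma_d$ be the $d+1$ largest singular values, with multiplicity, of $A$ and of $P$, respectively. Suppose that, for some constants $C>c>0$ that do not depend on $n$, $$\Delta=\omega(\log^4 n),\qquad \sigma_1\ge C\Delta,\qquad \sigma_0\le c\Delta,$$ where the last two inequalities are required for all sufficiently large $n$ (so that $\sigma_0<\sigma_1$ for all large $n$). **Theorem.** Let $\delta\in(0,1]$. For each $k\in\{1,\dots,d\}$ there is a constant $c_{k,d}>0$, depending only on $k$ and $d$, such that, as $n\to\infty$,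 with probability $1-o(1)$, $$|\hat\sigma_k-\sigma_k|\le c_{k,d}\,\log^\delta n .$$ As a consequence, with no assumption on the gaps between $\sigma_1,\dots,\sigma_d$, there is a constant $c_d>0$, depending only on $d$, such that, with probability $1-o(1)$, $$\Big(\sum_{k=1}^d|\hat\sigma_k-\sigma_k|^2\Big)^{1/2}\le c_d\log n .$$ If moreover, for all sufficiently large $n$, the $d$ largest singular values of $P$ are its $d$ largest eigenvalues $\lambda_1(P)\le\dots\le\lambda_d(P)$ (that is, $\lambda_k(P)=\sigma_k$ for $1\le k\le d$; for instance if $P$ is positive semidefinite), and $\lambda_1(A)\le\dots\le\lambda_d(A)$ denote the $d$ largest eigenvalues of $A$, with multiplicity, then, with probability $1-o(1)$, $$\Big(\sum_{k=1}^d|\lambda_k(A)-\lambda_k(P)|^2\Big)^{1/2}\le c_d\log n .$$ -/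

import Mathlib

open MeasureTheory ProbabilityTheory Filter Topology Asymptotics

/-- `IsIERM μ P A`: under the probability measure `μ`, the random matrix `A` is the adjacency matrix
of an inhomogeneous Erdős–Rényi random graph on `n` vertices with symmetric edge probability matrix
`P ∈ [0,1]^{n × n}`. That is, `A` is symmetric with entries in `{0, 1}`, the entries `A i j` with
`i ≤ j` are independent, and `A i j` is Bernoulli with parameter `P i j`. -/
structure IsIERM {n : ℕ} {Ω : Type*} [MeasurableSpace Ω] (μ : Measure Ω)
    (P : Matrix (Fin n) (Fin n) ℝ) (A : Ω → Matrix (Fin n) (Fin n) ℝ) : Prop where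
  prob_symm : P.IsSymm
  prob_mem : ∀ i j, P i j ∈ Set.Icc (0 : ℝ) 1
  adj_symm : ∀ ω, (A ω).IsSymm
  adj_binary : ∀ ω i j, A ω i j = 0 ∨ A ω i j = 1
  measurable_entry : ∀ i j, Measurable fun ω => A ω i j
  bernoulli : ∀ i j, μ {ω | A ω i j = 1} = ENNReal.ofReal (P i j)
  indep : iIndepFun (fun (p : {p : Fin n × Fin n // p.1 ≤ p.2}) ω => A ω p.1.1 p.1.2) μ

/-- The maximum expected degree `Δ = max_i ∑_j P i j` (it is `0` when there are no vertices). -/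
noncomputable def maxExpectedDegree {n : ℕ} (P : Matrix (Fin n) (Fin n) ℝ) : ℝ :=
  ⨆ i, ∑ j, P i j

/-- For `k ≤ d`, the `k`-th of the `d + 1` largest singular values `σ₀ ≤ σ₁ ≤ ⋯ ≤ σ_d` of `M`, listed
in increasing order with multiplicity. Mathlib's `singularValues` is the decreasing list indexed from
`0`, so `σ_k` is its entry `d - k`. (The list is padded by zeros when `n < d + 1`.) -/
noncomputable def topSingularValue {n : ℕ} (d : ℕ) (M : Matrix (Fin n) (Fin n) ℝ) (k : ℕ) : ℝ :=
  (Matrix.toEuclideanLin M).singularValues (d - k)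

open Classical in
/-- For a real symmetric matrix `M` and `1 ≤ k ≤ d ≤ n`, the `k`-th of the `d` largest eigenvalues
`λ₁ ≤ ⋯ ≤ λ_d` of `M`, listed in increasing order with multiplicity. Mathlib's `eigenvalues₀` is the
decreasing list indexed from `0`, so `λ_k` is its entry `d - k`. (The value is `0` when there is no
such entry.) -/
noncomputable def topEigenvalue {n : ℕ} (d : ℕ) (M : Matrix (Fin n) (Fin n) ℝ) (k : ℕ) : ℝ :=
  if h : M.IsHermitian ∧ d - k < n then
    h.1.eigenvalues₀ ⟨d - k, by simpa using h.2⟩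
  else 0

/-- The hypotheses on a sequence of edge probability matrices `P n` (one for every number `n` of
vertices), with `Δ n` the maximum expected degree of `P n`: `Δ n = ω(log⁴ n)` and, for all large `n`,
`σ₁(P n) ≥ C Δ n` and `σ₀(P n) ≤ c Δ n`. -/
structure HasSpikes (d : ℕ) (C c : ℝ) (P : ∀ n : ℕ, Matrix (Fin n) (Fin n) ℝ) : Prop where
  degree_growth :
    (fun n : ℕ => Real.log n ^ 4) =o[atTop] fun n : ℕ => maxExpectedDegree (P n)
  signal : ∀ᶠ n : ℕ in atTop, C * maxExpectedDegree (P n) ≤ topSingularValue d (P n) 1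
  noise : ∀ᶠ n : ℕ in atTop, topSingularValue d (P n) 0 ≤ c * maxExpectedDegree (P n)

/-! Write `X = A - P`. Weyl's inequality would lose the whole norm of `X`. Instead `X` is compared
with `P` along the `d` leading singular directions `u i`, `w i` of `P`. These are deterministic, so
`X` acts on them much more weakly than in operator norm: `⟪w j, X u i⟫` has second moment at most
`2`, and `‖X u i‖ ^ 2`, `‖X w j‖ ^ 2` have mean at most `Δ`.

The lower bound (`singularValues_sub_le`) tests `A` on the leading span and sees only the `d × d`
block of `X`. For the upper bound (`singularValues_le_add`), splitting both sides into leading and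
remaining parts gives a `2 × 2` form with diagonal `σ_k + O(1)`-type and `σ_0 + ‖X‖`, and
off-diagonal entry of order `√Δ`, up to logarithmic factors. Its norm exceeds the top entry by at
most (off-diagonal)² / gap (`quadratic_form_le`). The gap is of order `Δ`, so the large entries
contribute only a power of `log n` at second order.

The operator norm is needed only to stay below a small multiple of `Δ`, and a trace moment of order
about `2 log n` gives this (`integral_trace_pow_le`). Markov's inequality, applied to boundedly many
test vectors at thresholds carrying `log ^ (δ/2) n`, leaves another `log ^ (δ/2) n` to absorb all
constants.

For eigenvalues, the lower bound is the same argument with eigenvectors of `P`; the upper bound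
follows from `λ_k(A) ≤ σ_k(A)`. -/

section LinearAlgebra

open Module
open scoped InnerProductSpace

/-! ### Coordinate projections in an orthonormal basis -/

variable {V : Type*} [NormedAddCommGroup V] [InnerProductSpace ℝ V]

/-- The component of `x` in the span of the vectors `b i`, `i ∈ s`, of an orthonormal basis. -/
noncomputable def basisProj {ι : Type*} [Fintype ι] (b : OrthonormalBasis ι ℝ V) (s : Finset ι)
    (x : V) : V :=
  ∑ i ∈ s, ⟪b i, x⟫_ℝ • b i

theorem norm_sq_basisProj {ι : Type*} [Fintype ι] (b : OrthonormalBasis ι ℝ V) (s : Finset ι)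
    (x : V) : ‖basisProj b s x‖ ^ 2 = ∑ i ∈ s, ⟪b i, x⟫_ℝ ^ 2 := by
  rw [← real_inner_self_eq_norm_sq, basisProj, b.orthonormal.inner_sum]
  simp [sq]

theorem inner_basis_basisProj {ι : Type*} [Fintype ι] [DecidableEq ι] (b : OrthonormalBasis ι ℝ V)
    (s : Finset ι) (x : V) (j : ι) :
    ⟪b j, basisProj b s x⟫_ℝ = if j ∈ s then ⟪b j, x⟫_ℝ else 0 := by
  rw [basisProj, inner_sum]
  simp [inner_smul_right, b.inner_eq_ite]

theorem inner_basis_sub_basisProj {ι : Type*} [Fintype ι] [DecidableEq ι]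
    (b : OrthonormalBasis ι ℝ V) (s : Finset ι) (x : V) (j : ι) :
    ⟪b j, x - basisProj b s x⟫_ℝ = if j ∈ s then 0 else ⟪b j, x⟫_ℝ := by
  rw [inner_sub_right, inner_basis_basisProj]
  split_ifs <;> simp

theorem OrthonormalBasis.norm_sq_eq_sum_inner_sq {ι : Type*} [Fintype ι]
    (b : OrthonormalBasis ι ℝ V) (x : V) : ‖x‖ ^ 2 = ∑ i, ⟪b i, x⟫_ℝ ^ 2 := by
  rw [← b.sum_sq_norm_inner_right x]
  simp

theorem norm_sq_basisProj_add {ι : Type*} [Fintype ι] [DecidableEq ι]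
    (b : OrthonormalBasis ι ℝ V) (s : Finset ι) (x : V) :
    ‖basisProj b s x‖ ^ 2 + ‖x - basisProj b s x‖ ^ 2 = ‖x‖ ^ 2 := by
  rw [b.norm_sq_eq_sum_inner_sq x, b.norm_sq_eq_sum_inner_sq (x - basisProj b s x),
    b.norm_sq_eq_sum_inner_sq (basisProj b s x), ← Finset.sum_add_distrib]
  refine Finset.sum_congr rfl fun i _ => ?_
  rw [inner_basis_sub_basisProj, inner_basis_basisProj]
  split_ifs <;> simp

/-- Cauchy–Schwarz on the coefficients: control of `Y` on finitely many basis vectors gives control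
on their span, at the cost of the square root of their number. -/
theorem norm_map_basisProj_le {ι W : Type*} [Fintype ι] [NormedAddCommGroup W] [NormedSpace ℝ W]
    (b : OrthonormalBasis ι ℝ V) (s : Finset ι) (Y : V →ₗ[ℝ] W) {ρ : ℝ}
    (hY : ∀ i ∈ s, ‖Y (b i)‖ ≤ ρ) (x : V) :
    ‖Y (basisProj b s x)‖ ≤ √(s.card) * ρ * ‖basisProj b s x‖ := by
  rcases s.eq_empty_or_nonempty with rfl | ⟨i₀, hi₀⟩
  · simp [basisProj]
  have hρ : 0 ≤ ρ := (norm_nonneg _).trans (hY i₀ hi₀)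
  have h1 : ∑ i ∈ s, |⟪b i, x⟫_ℝ| ≤ √(s.card) * ‖basisProj b s x‖ := by
    rw [← Real.sqrt_sq (norm_nonneg (basisProj b s x)), ← Real.sqrt_mul (by positivity),
      norm_sq_basisProj]
    refine Real.le_sqrt_of_sq_le ?_
    simpa using sq_sum_le_card_mul_sum_sq (s := s) (f := fun i => |⟪b i, x⟫_ℝ|)
  calc ‖Y (basisProj b s x)‖ ≤ ∑ i ∈ s, ‖⟪b i, x⟫_ℝ • Y (b i)‖ := by
        rw [basisProj, map_sum]
        simp only [map_smul]
        exact norm_sum_le _ _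
    _ ≤ ∑ i ∈ s, |⟪b i, x⟫_ℝ| * ρ := by
        refine Finset.sum_le_sum fun i hi => ?_
        rw [norm_smul, Real.norm_eq_abs]
        exact mul_le_mul_of_nonneg_left (hY i hi) (abs_nonneg _)
    _ = (∑ i ∈ s, |⟪b i, x⟫_ℝ|) * ρ := by rw [Finset.sum_mul]
    _ ≤ √(s.card) * ‖basisProj b s x‖ * ρ := mul_le_mul_of_nonneg_right h1 hρ
    _ = _ := by ring

theorem abs_inner_map_basisProj_le {ι : Type*} [Fintype ι]
    (b b' : OrthonormalBasis ι ℝ V) (s s' : Finset ι) {N : ℕ} (hs : s.card ≤ N) (hs' : s'.card ≤ N)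
    (Y : V →ₗ[ℝ] V) {ε : ℝ} (hε : 0 ≤ ε)
    (hY : ∀ i ∈ s, ∀ j ∈ s', |⟪b' j, Y (b i)⟫_ℝ| ≤ ε) (x z : V) :
    |⟪basisProj b' s' z, Y (basisProj b s x)⟫_ℝ| ≤
      N * ε * ‖basisProj b' s' z‖ * ‖basisProj b s x‖ := by
  have hN : √(s.card) * √(s'.card) ≤ (N : ℝ) := by
    rw [← Real.mul_self_sqrt (Nat.cast_nonneg N)]
    gcongr
  -- The preceding lemma is used twice on functionals: here for each `⟪b' j, Y ·⟫`, then for `⟪Y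
  -- (basisProj b s x), ·⟫`.
  have h1 : ∀ j ∈ s', |⟪b' j, Y (basisProj b s x)⟫_ℝ| ≤ √(s.card) * ε * ‖basisProj b s x‖ :=
    fun j hj => norm_map_basisProj_le b s ((innerₛₗ ℝ (b' j)).comp Y) (fun i hi => hY i hi j hj) x
  have h2 := norm_map_basisProj_le b' s' (innerₛₗ ℝ (Y (basisProj b s x)))
    (ρ := √(s.card) * ε * ‖basisProj b s x‖)
    (fun j hj => by simpa [real_inner_comm] using h1 j hj) z
  rw [real_inner_comm]
  calc |⟪Y (basisProj b s x), basisProj b' s' z⟫_ℝ|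
      ≤ √(s'.card) * (√(s.card) * ε * ‖basisProj b s x‖) * ‖basisProj b' s' z‖ := h2
    _ = (√(s.card) * √(s'.card)) * (ε * ‖basisProj b' s' z‖ * ‖basisProj b s x‖) := by ring
    _ ≤ N * (ε * ‖basisProj b' s' z‖ * ‖basisProj b s x‖) := by gcongr
    _ = _ := by ring

/-! ### Singular value decomposition and minimax test vectors -/

variable [FiniteDimensional ℝ V]

/-- Only `n - 1` linear conditions are imposed. The resulting `x` serves as a test vector at level
`m` for two operators at once, which replaces the Courant–Fischer formula throughout. -/
theorem exists_ne_zero_forall_inner_eq_zero {n : ℕ} (hn : finrank ℝ V = n) (b b' : Fin n → V)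
    (m : Fin n) :
    ∃ x : V, x ≠ 0 ∧ (∀ i, m < i → ⟪b i, x⟫_ℝ = 0) ∧ ∀ i, i < m → ⟪b' i, x⟫_ℝ = 0 := by
  let L : V →ₗ[ℝ] ({i : Fin n // i ≠ m} → ℝ) :=
    LinearMap.pi fun i => if m < i.1 then innerₛₗ ℝ (b i.1) else innerₛₗ ℝ (b' i.1)
  have hL : LinearMap.ker L ≠ ⊥ := by
    apply LinearMap.ker_ne_bot_of_finrank_lt
    rw [finrank_fintype_fun_eq_card, hn]
    have := m.pos
    simp
    omega
  obtain ⟨x, hx, hx0⟩ := (Submodule.ne_bot_iff _).1 hL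
  have hx' : ∀ i : {i : Fin n // i ≠ m}, L x i = 0 := fun i => by
    rw [LinearMap.mem_ker.1 hx]; rfl
  refine ⟨x, hx0, fun i hi => ?_, fun i hi => ?_⟩
  · simpa [L, hi] using hx' ⟨i, hi.ne'⟩
  · simpa [L, hi.not_gt] using hx' ⟨i, hi.ne⟩

/-- The singular value decomposition of an endomorphism. -/
theorem LinearMap.exists_svd {n : ℕ} (hn : finrank ℝ V = n) (T : V →ₗ[ℝ] V) :
    ∃ u w : OrthonormalBasis (Fin n) ℝ V, ∀ i : Fin n, T (u i) = T.singularValues i • w i := by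
  classical
  have hS := T.isSymmetric_adjoint_comp_self
  let u := hS.eigenvectorBasis hn
  have hTT : ∀ i j, ⟪T (u i), T (u j)⟫_ℝ = if i = j then T.singularValues j ^ 2 else 0 := by
    intro i j
    rw [← LinearMap.adjoint_inner_right, ← LinearMap.comp_apply,
      hS.apply_eigenvectorBasis hn j, inner_smul_right, u.inner_eq_ite, T.sq_singularValues_fin hn]
    simp
  -- The left singular vectors are forced where the singular value is nonzero. Elsewhere `T (u i) =
  -- 0`, so any orthonormal completion works.
  let v : Fin n → V := fun i => (T.singularValues i)⁻¹ • T (u i)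
  have hv : Orthonormal ℝ (Set.domRestrict {i : Fin n | T.singularValues i ≠ 0} v) := by
    rw [orthonormal_iff_ite]
    rintro ⟨i, hi⟩ ⟨j, hj⟩
    simp only [Set.domRestrict_apply, v, inner_smul_left, inner_smul_right, hTT, Subtype.mk.injEq]
    split_ifs with h
    · subst h
      simp only [Set.mem_ofPred_eq] at hi
      simp
      field_simp
    · simp
  obtain ⟨w, hw⟩ := hv.exists_orthonormalBasis_extension_of_card_eq (by simpa using hn)
  refine ⟨u, w, fun i => ?_⟩
  by_cases hi : T.singularValues i = 0
  · have := hTT i i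
    rw [hi] at this ⊢
    simpa using this
  · rw [hw i hi]
    simp only [v]
    rw [smul_smul, mul_inv_cancel₀ hi, one_smul]

omit [FiniteDimensional ℝ V] in
theorem norm_sq_map_of_svd {n : ℕ} {T : V →ₗ[ℝ] V} {σ : Fin n → ℝ}
    {u w : OrthonormalBasis (Fin n) ℝ V} (h : ∀ i, T (u i) = σ i • w i) (x : V) :
    ‖T x‖ ^ 2 = ∑ i, σ i ^ 2 * ⟪u i, x⟫_ℝ ^ 2 := by
  have : T x = ∑ i, (⟪u i, x⟫_ℝ * σ i) • w i := by
    conv_lhs => rw [← u.sum_repr' x, map_sum]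
    simp [h, smul_smul]
  rw [this, ← real_inner_self_eq_norm_sq, w.orthonormal.inner_sum]
  refine Finset.sum_congr rfl fun i _ => ?_
  simp
  ring

omit [FiniteDimensional ℝ V] in
theorem norm_map_le_of_svd {n : ℕ} {T : V →ₗ[ℝ] V} {σ : Fin n → ℝ} (hσ0 : ∀ i, 0 ≤ σ i)
    (hσ : Antitone σ) {u w : OrthonormalBasis (Fin n) ℝ V} (h : ∀ i, T (u i) = σ i • w i)
    (m : Fin n) {x : V} (hx : ∀ i, i < m → ⟪u i, x⟫_ℝ = 0) : ‖T x‖ ≤ σ m * ‖x‖ := by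
  refine abs_le_of_sq_le_sq' ?_ (by have := hσ0 m; positivity) |>.2
  rw [norm_sq_map_of_svd h, mul_pow, u.norm_sq_eq_sum_inner_sq, Finset.mul_sum]
  refine Finset.sum_le_sum fun i _ => ?_
  rcases lt_or_ge i m with hi | hi
  · simp [hx i hi]
  · have := hσ0 i
    have := hσ hi
    gcongr

omit [FiniteDimensional ℝ V] in
theorem le_norm_map_of_svd {n : ℕ} {T : V →ₗ[ℝ] V} {σ : Fin n → ℝ} (hσ0 : ∀ i, 0 ≤ σ i)
    (hσ : Antitone σ) {u w : OrthonormalBasis (Fin n) ℝ V} (h : ∀ i, T (u i) = σ i • w i)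
    (m : Fin n) {x : V} (hx : ∀ i, m < i → ⟪u i, x⟫_ℝ = 0) : σ m * ‖x‖ ≤ ‖T x‖ := by
  refine abs_le_of_sq_le_sq' ?_ (norm_nonneg _) |>.2
  rw [norm_sq_map_of_svd h, mul_pow, u.norm_sq_eq_sum_inner_sq, Finset.mul_sum]
  refine Finset.sum_le_sum fun i _ => ?_
  rcases lt_or_ge m i with hi | hi
  · simp [hx i hi]
  · have := hσ0 m
    have := hσ hi
    gcongr

theorem singularValues_fin_antitone {n : ℕ} (T : V →ₗ[ℝ] V) :
    Antitone fun i : Fin n => T.singularValues i :=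
  fun _ _ hij => T.singularValues_antitone hij

omit [FiniteDimensional ℝ V] in
theorem basisProj_eq_self {ι : Type*} [Fintype ι] [DecidableEq ι]
    (b : OrthonormalBasis ι ℝ V) (s : Finset ι) {x : V} (hx : ∀ i, i ∉ s → ⟪b i, x⟫_ℝ = 0) :
    basisProj b s x = x := by
  rw [basisProj]
  conv_rhs => rw [← b.sum_repr' x]
  refine Finset.sum_subset (Finset.subset_univ _) fun i _ hi => ?_
  simp [hx i hi]

/-! ### Deterministic perturbation bounds for singular values -/

/-- On the span of the first `m + 1` right singular vectors of `P`, pair `A x` with `P x`: the error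
`⟪P x, (A - P) x⟫` involves only the leading block of the noise, because `P x` lies in the span of
the matching `w j`. No gap is needed. -/
theorem singularValues_sub_le {n : ℕ} (hn : finrank ℝ V = n) (A P : V →ₗ[ℝ] V)
    {u w : OrthonormalBasis (Fin n) ℝ V} (h : ∀ i : Fin n, P (u i) = P.singularValues i • w i)
    {ε : ℝ} (hε : 0 ≤ ε) {d : ℕ} {m : Fin n} (hm : (m : ℕ) < d)
    (h1 : ∀ i j : Fin n, (i : ℕ) < d → (j : ℕ) < d → |⟪w j, (A - P) (u i)⟫_ℝ| ≤ ε) :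
    P.singularValues m - d * ε ≤ A.singularValues m := by
  classical
  obtain ⟨a, a', ha⟩ := A.exists_svd hn
  obtain ⟨x, hx0, hx1, hx2⟩ := exists_ne_zero_forall_inner_eq_zero hn u a m
  have hA := norm_map_le_of_svd (fun i => A.singularValues_nonneg i)
    (singularValues_fin_antitone A) ha m hx2
  have hP := le_norm_map_of_svd (fun i => P.singularValues_nonneg i)
    (singularValues_fin_antitone P) h m hx1
  have hs : (Finset.Iic m).card ≤ d := by simp; omega
  have hxs : basisProj u (Finset.Iic m) x = x :=
    basisProj_eq_self u _ fun i hi => hx1 i (by simpa using hi)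
  have hPx : basisProj w (Finset.Iic m) (P x) = P x := by
    refine basisProj_eq_self w _ fun i hi => ?_
    rw [← u.sum_repr' x, map_sum, inner_sum]
    refine Finset.sum_eq_zero fun j _ => ?_
    simp only [map_smul, h, inner_smul_right, w.inner_eq_ite]
    split_ifs with hij
    · subst hij
      simp [hx1 i (by simpa using hi)]
    · simp
  have hb := abs_inner_map_basisProj_le u w (Finset.Iic m) (Finset.Iic m) hs hs (A - P) hε
    (fun i hi j hj => h1 i j (by simp at hi; omega) (by simp at hj; omega)) x (P x)
  rw [hxs, hPx] at hb
  have hxp : 0 < ‖x‖ := norm_pos_iff.2 hx0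
  have key : ‖P x‖ - d * ε * ‖x‖ ≤ ‖A x‖ := by
    rcases (norm_nonneg (P x)).eq_or_lt with h0 | h0
    · rw [← h0]
      have : 0 ≤ d * ε * ‖x‖ := by positivity
      linarith [norm_nonneg (A x)]
    · have h3 : ⟪P x, A x⟫_ℝ = ‖P x‖ ^ 2 + ⟪P x, (A - P) x⟫_ℝ := by
        rw [← real_inner_self_eq_norm_sq, ← inner_add_right]
        simp
      have h4 := real_inner_le_norm (P x) (A x)
      have h5 := (abs_le.1 hb).1
      refine le_of_mul_le_mul_left ?_ h0
      nlinarith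
  have : (P.singularValues m - d * ε) * ‖x‖ ≤ A.singularValues m * ‖x‖ := by linarith
  exact le_of_mul_le_mul_right this hxp

/-- The symmetric matrix with rows `(s, r)`, `(r, t)` has norm at most `s + θ`: its off-diagonal
entry counts only through `r ^ 2 / (s - t)`. This is the source of the second-order gain. -/
theorem quadratic_form_le {s t r θ a b a' b' X Z : ℝ} (ht : t ≤ s) (hθ : 0 ≤ θ)
    (hr : r ^ 2 ≤ θ * (s - t)) (h0 : 0 ≤ t) (hX : 0 ≤ X) (hZ : 0 ≤ Z)
    (hX2 : a ^ 2 + b ^ 2 = X ^ 2) (hZ2 : a' ^ 2 + b' ^ 2 = Z ^ 2) :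
    s * a * a' + r * (a * b' + b * a') + t * b * b' ≤ (s + θ) * X * Z := by
  have hst : 0 ≤ s - t := by linarith
  have h1 : ∀ p q : ℝ, |2 * r * p * q| ≤ θ * p ^ 2 + (s - t) * q ^ 2 := by
    intro p q
    have h3 : (2 * r * p * q) ^ 2 ≤ (θ * p ^ 2 + (s - t) * q ^ 2) ^ 2 := by
      have : r ^ 2 * (p ^ 2 * q ^ 2) ≤ θ * (s - t) * (p ^ 2 * q ^ 2) := by gcongr
      nlinarith [sq_nonneg (θ * p ^ 2 - (s - t) * q ^ 2)]
    exact abs_le.2 (abs_le_of_sq_le_sq' h3 (by positivity))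
  rcases hX.eq_or_lt with h | hXp
  · subst h
    have ha : a = 0 := by nlinarith [sq_nonneg a, sq_nonneg b]
    have hb : b = 0 := by nlinarith [sq_nonneg a, sq_nonneg b]
    simp [ha, hb]
  rcases hZ.eq_or_lt with h | hZp
  · subst h
    have ha : a' = 0 := by nlinarith [sq_nonneg a', sq_nonneg b']
    have hb : b' = 0 := by nlinarith [sq_nonneg a', sq_nonneg b']
    simp [ha, hb]
  -- Polarization: rescaling the vectors by `Z` and `X` to a common length writes the bilinear form
  -- as a difference of quadratic forms at their sum and difference.
  have h2 := (abs_le.1 (h1 (a * Z + a' * X) (b * Z + b' * X))).2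
  have h3 := (abs_le.1 (h1 (a * Z - a' * X) (b * Z - b' * X))).1
  have h4 : 0 ≤ θ * (b * Z + b' * X) ^ 2 := by positivity
  have h5 : 0 ≤ t * (a * Z - a' * X) ^ 2 := by positivity
  have h6 : 0 ≤ (s - t) * (a * Z - a' * X) ^ 2 := by positivity
  have h7 : 0 ≤ θ * (b * Z - b' * X) ^ 2 := by positivity
  have h8 : 0 ≤ t * (b * Z - b' * X) ^ 2 := by positivity
  have h9 : (s + θ) * ((a * Z + a' * X) ^ 2 + (b * Z + b' * X) ^ 2)
      + (s + θ) * ((a * Z - a' * X) ^ 2 + (b * Z - b' * X) ^ 2)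
      = 4 * ((s + θ) * X * Z) * (X * Z) := by
    linear_combination (2 * (s + θ) * Z ^ 2) * hX2 + (2 * (s + θ) * X ^ 2) * hZ2
  refine le_of_mul_le_mul_right ?_ (mul_pos hXp hZp)
  nlinarith

/-- Expand `‖A x‖ ^ 2 = ⟪P x, A x⟫ + ⟪(A - P) x, A x⟫` after splitting `x` along the first `d`
vectors `u` and `A x` along the first `d` vectors `w`. `P` is block diagonal for this splitting, so
the off-diagonal blocks are pure noise and `quadratic_form_le` applies. -/
theorem singularValues_le_add {n : ℕ} (hn : finrank ℝ V = n) (A P : V →ₗ[ℝ] V)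
    (hX : (A - P).IsSymmetric)
    {u w : OrthonormalBasis (Fin n) ℝ V} (h : ∀ i : Fin n, P (u i) = P.singularValues i • w i)
    {ε ρ η : ℝ} (hε : 0 ≤ ε) (hρ : 0 ≤ ρ) (hη : 0 ≤ η) {d : ℕ} {m : Fin n}
    (h1 : ∀ i j : Fin n, (i : ℕ) < d → (j : ℕ) < d → |⟪w j, (A - P) (u i)⟫_ℝ| ≤ ε)
    (h2 : ∀ i : Fin n, (i : ℕ) < d → ‖(A - P) (u i)‖ ≤ ρ)
    (h3 : ∀ j : Fin n, (j : ℕ) < d → ‖(A - P) (w j)‖ ≤ ρ)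
    (h4 : ∀ x, ‖(A - P) x‖ ≤ η * ‖x‖)
    (hgap : P.singularValues d + η < P.singularValues m) :
    A.singularValues m ≤ P.singularValues m + d * ε
      + d * ρ ^ 2 / (P.singularValues m - (P.singularValues d + η)) := by
  classical
  obtain ⟨a, a', ha⟩ := A.exists_svd hn
  obtain ⟨x, hx0, hx1, hx2⟩ := exists_ne_zero_forall_inner_eq_zero hn a u m
  have hA := le_norm_map_of_svd (fun i => A.singularValues_nonneg i)
    (singularValues_fin_antitone A) ha m hx1
  set S : Finset (Fin n) := {i : Fin n | (i : ℕ) < d} with hS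
  have hSc : S.card ≤ d := by
    rw [hS, Fin.card_filter_val_lt]
    exact min_le_right _ _
  have hmS : ∀ i, i ∈ S ↔ (i : ℕ) < d := by simp [hS]
  have hsq : √(S.card : ℝ) ≤ √d := Real.sqrt_le_sqrt (by exact_mod_cast hSc)
  set z := A x with hz
  set x₁ := basisProj u S x with hx₁
  set x₂ := x - x₁ with hx₂
  set z₁ := basisProj w S z with hz₁
  set z₂ := z - z₁ with hz₂
  set t := P.singularValues d + η with ht
  have ht0 : 0 ≤ t := add_nonneg (P.singularValues_nonneg d) hη
  set σ := P.singularValues m with hσ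
  have e1 : ⟪P x₁, z₁⟫_ℝ ≤ σ * ‖x₁‖ * ‖z₁‖ := by
    refine (real_inner_le_norm _ _).trans ?_
    gcongr
    refine norm_map_le_of_svd (fun i => P.singularValues_nonneg i)
      (singularValues_fin_antitone P) h m fun i hi => ?_
    rw [inner_basis_basisProj, hx2 i hi, ite_self]
  have e2 : ⟪P x₂, z₂⟫_ℝ ≤ P.singularValues d * ‖x₂‖ * ‖z₂‖ := by
    refine (real_inner_le_norm _ _).trans ?_
    gcongr
    -- When `n ≤ d` there is no singular direction beyond the leading ones, so `x₂` vanishes.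
    by_cases hdn : d < n
    · refine norm_map_le_of_svd (m := ⟨d, hdn⟩) (fun i => P.singularValues_nonneg i)
        (singularValues_fin_antitone P) h fun i hi => ?_
      rw [inner_basis_sub_basisProj, if_pos ((hmS i).2 hi)]
    · have : x₂ = 0 := by
        rw [hx₂, sub_eq_zero]
        exact (basisProj_eq_self u S fun i hi => absurd ((hmS i).2 (by omega)) hi).symm
      simp [this]
  have hPcoef : ∀ (y : V) (j : Fin n), ⟪w j, P y⟫_ℝ = P.singularValues j * ⟪u j, y⟫_ℝ := by
    intro y j
    conv_lhs => rw [← u.sum_repr' y, map_sum, inner_sum]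
    simp [h, inner_smul_right, w.inner_eq_ite, mul_comm]
  have e3 : ⟪P x₂, z₁⟫_ℝ = 0 := by
    rw [hz₁, basisProj, inner_sum]
    refine Finset.sum_eq_zero fun j hj => ?_
    rw [inner_smul_right, real_inner_comm (w j) (P x₂), hPcoef, inner_basis_sub_basisProj, if_pos hj]
    simp
  have e4 : ⟪P x₁, z₂⟫_ℝ = 0 := by
    rw [real_inner_comm, ← w.sum_inner_mul_inner]
    refine Finset.sum_eq_zero fun j _ => ?_
    rw [hPcoef, inner_basis_basisProj, real_inner_comm, inner_basis_sub_basisProj]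
    split_ifs <;> simp
  have e5 : ⟪(A - P) x₁, z₁⟫_ℝ ≤ d * ε * ‖x₁‖ * ‖z₁‖ := by
    have := abs_inner_map_basisProj_le u w S S hSc hSc (A - P) hε
      (fun i hi j hj => h1 i j ((hmS i).1 hi) ((hmS j).1 hj)) x z
    rw [real_inner_comm]
    refine (le_abs_self _).trans (this.trans_eq ?_)
    ring
  have e6 : ⟪(A - P) x₁, z₂⟫_ℝ ≤ √d * ρ * ‖x₁‖ * ‖z₂‖ := by
    refine (real_inner_le_norm _ _).trans ?_
    gcongr
    refine (norm_map_basisProj_le u S (A - P) (fun i hi => h2 i ((hmS i).1 hi)) x).trans ?_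
    gcongr
  have e7 : ⟪(A - P) x₂, z₁⟫_ℝ ≤ √d * ρ * ‖x₂‖ * ‖z₁‖ := by
    -- Symmetry of the noise moves it onto `z₁`, where the bound on the vectors `w j` applies.
    rw [hX, mul_right_comm, mul_comm]
    refine (real_inner_le_norm _ _).trans ?_
    gcongr
    refine (norm_map_basisProj_le w S (A - P) (fun i hi => h3 i ((hmS i).1 hi)) z).trans ?_
    gcongr
  have e8 : ⟪(A - P) x₂, z₂⟫_ℝ ≤ η * ‖x₂‖ * ‖z₂‖ := by
    refine (real_inner_le_norm _ _).trans ?_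
    gcongr
    exact h4 _
  have hexp : ‖z‖ ^ 2 = ⟪P x₁, z₁⟫_ℝ + ⟪P x₂, z₂⟫_ℝ + ⟪P x₂, z₁⟫_ℝ + ⟪P x₁, z₂⟫_ℝ
      + ⟪(A - P) x₁, z₁⟫_ℝ + ⟪(A - P) x₁, z₂⟫_ℝ + ⟪(A - P) x₂, z₁⟫_ℝ + ⟪(A - P) x₂, z₂⟫_ℝ := by
    have hx : x = x₁ + x₂ := by simp [hx₂]
    have hz' : z = z₁ + z₂ := by simp [hz₂]
    rw [← real_inner_self_eq_norm_sq]
    calc ⟪z, z⟫_ℝ = ⟪P (x₁ + x₂) + (A - P) (x₁ + x₂), z₁ + z₂⟫_ℝ := by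
          rw [← hx, ← hz']; simp [hz]
      _ = _ := by
          simp only [map_add, inner_add_left, inner_add_right]
          ring
  have hd0 : (0 : ℝ) ≤ d := Nat.cast_nonneg d
  have hdε : 0 ≤ d * ε := mul_nonneg hd0 hε
  have hgap' : 0 < σ - t := sub_pos.2 hgap
  -- `θ` is chosen so that `r ^ 2 = θ * (σ - t)`.
  have hq := quadratic_form_le (s := σ + d * ε) (t := t) (r := √d * ρ)
    (θ := d * ρ ^ 2 / (σ - t)) (a := ‖x₁‖) (b := ‖x₂‖) (a' := ‖z₁‖) (b' := ‖z₂‖)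
    (by linarith) (by positivity) ?_ ht0 (norm_nonneg x) (norm_nonneg z)
    (norm_sq_basisProj_add u S x) (norm_sq_basisProj_add w S z)
  · have hz2 : ‖z‖ ^ 2 ≤ (σ + d * ε + d * ρ ^ 2 / (σ - t)) * ‖x‖ * ‖z‖ := by
      refine le_trans ?_ hq
      rw [hexp, e3, e4, ht]
      linarith
    have hxp : 0 < ‖x‖ := norm_pos_iff.2 hx0
    have hσ0 : 0 ≤ σ := P.singularValues_nonneg m
    refine le_of_mul_le_mul_right (hA.trans ?_) hxp
    rcases (norm_nonneg z).eq_or_lt with h0 | h0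
    · rw [← h0]
      positivity
    · refine le_of_mul_le_mul_right ?_ h0
      rw [← sq]
      exact hz2
  · rw [mul_pow, Real.sq_sqrt hd0, div_mul_eq_mul_div, le_div_iff₀ hgap']
    gcongr
    linarith

/-! ### Minimax and perturbation bounds for eigenvalues -/

section Eigenvalues

variable {n : ℕ} (hn : finrank ℝ V = n)

theorem inner_map_eq_sum_eigenvalues {T : V →ₗ[ℝ] V} (hT : T.IsSymmetric) (x : V) :
    ⟪x, T x⟫_ℝ = ∑ i, hT.eigenvalues hn i * ⟪hT.eigenvectorBasis hn i, x⟫_ℝ ^ 2 := by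
  rw [← (hT.eigenvectorBasis hn).sum_inner_mul_inner]
  refine Finset.sum_congr rfl fun i _ => ?_
  rw [← hT, hT.apply_eigenvectorBasis, inner_smul_left, real_inner_comm]
  simp
  ring

theorem inner_map_le_eigenvalues {T : V →ₗ[ℝ] V} (hT : T.IsSymmetric) (m : Fin n) {x : V}
    (hx : ∀ i, i < m → ⟪hT.eigenvectorBasis hn i, x⟫_ℝ = 0) :
    ⟪x, T x⟫_ℝ ≤ hT.eigenvalues hn m * ‖x‖ ^ 2 := by
  rw [inner_map_eq_sum_eigenvalues hn hT, (hT.eigenvectorBasis hn).norm_sq_eq_sum_inner_sq x,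
    Finset.mul_sum]
  refine Finset.sum_le_sum fun i _ => ?_
  rcases lt_or_ge i m with hi | hi
  · simp [hx i hi]
  · have := hT.eigenvalues_antitone hn hi
    gcongr

theorem eigenvalues_le_inner_map {T : V →ₗ[ℝ] V} (hT : T.IsSymmetric) (m : Fin n) {x : V}
    (hx : ∀ i, m < i → ⟪hT.eigenvectorBasis hn i, x⟫_ℝ = 0) :
    hT.eigenvalues hn m * ‖x‖ ^ 2 ≤ ⟪x, T x⟫_ℝ := by
  rw [inner_map_eq_sum_eigenvalues hn hT, (hT.eigenvectorBasis hn).norm_sq_eq_sum_inner_sq x,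
    Finset.mul_sum]
  refine Finset.sum_le_sum fun i _ => ?_
  rcases lt_or_ge m i with hi | hi
  · simp [hx i hi]
  · have := hT.eigenvalues_antitone hn hi
    gcongr

theorem eigenvalues_le_singularValues {T : V →ₗ[ℝ] V} (hT : T.IsSymmetric) (m : Fin n) :
    hT.eigenvalues hn m ≤ T.singularValues m := by
  obtain ⟨a, a', ha⟩ := T.exists_svd hn
  obtain ⟨x, hx0, hx1, hx2⟩ :=
    exists_ne_zero_forall_inner_eq_zero hn (hT.eigenvectorBasis hn) a m
  have h1 := eigenvalues_le_inner_map hn hT m hx1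
  have h2 := norm_map_le_of_svd (fun i => T.singularValues_nonneg i)
    (singularValues_fin_antitone T) ha m hx2
  have hxp : 0 < ‖x‖ := norm_pos_iff.2 hx0
  have h3 := real_inner_le_norm x (T x)
  refine le_of_mul_le_mul_right ?_ (pow_pos hxp 2)
  nlinarith

theorem eigenvalues_sub_le {A P : V →ₗ[ℝ] V} (hA : A.IsSymmetric) (hP : P.IsSymmetric)
    {ε : ℝ} (hε : 0 ≤ ε) {d : ℕ} {m : Fin n} (hm : (m : ℕ) < d)
    (h1 : ∀ i j : Fin n, (i : ℕ) < d → (j : ℕ) < d →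
      |⟪hP.eigenvectorBasis hn j, (A - P) (hP.eigenvectorBasis hn i)⟫_ℝ| ≤ ε) :
    hP.eigenvalues hn m - d * ε ≤ hA.eigenvalues hn m := by
  obtain ⟨x, hx0, hx1, hx2⟩ := exists_ne_zero_forall_inner_eq_zero hn
    (hP.eigenvectorBasis hn) (hA.eigenvectorBasis hn) m
  have hAx := inner_map_le_eigenvalues hn hA m hx2
  have hPx := eigenvalues_le_inner_map hn hP m hx1
  have hs : (Finset.Iic m).card ≤ d := by simp; omega
  have hxs : basisProj (hP.eigenvectorBasis hn) (Finset.Iic m) x = x :=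
    basisProj_eq_self _ _ fun i hi => hx1 i (by simpa using hi)
  have hb := abs_inner_map_basisProj_le (hP.eigenvectorBasis hn) (hP.eigenvectorBasis hn)
    (Finset.Iic m) (Finset.Iic m) hs hs (A - P) hε
    (fun i hi j hj => h1 i j (by simp at hi; omega) (by simp at hj; omega)) x x
  rw [hxs] at hb
  have h2 := (abs_le.1 hb).1
  have h3 : ⟪x, A x⟫_ℝ = ⟪x, P x⟫_ℝ + ⟪x, (A - P) x⟫_ℝ := by
    rw [← inner_add_right]
    simp
  have hxp : 0 < ‖x‖ := norm_pos_iff.2 hx0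
  refine le_of_mul_le_mul_right ?_ (pow_pos hxp 2)
  nlinarith

end Eigenvalues

end LinearAlgebra

/-! ### Trace powers as sums over closed walks, and the norm bound they give -/

section TracePowers

open Module
open scoped InnerProductSpace

theorem Matrix.pow_apply_eq_sum_walks {n : ℕ} (M : Matrix (Fin n) (Fin n) ℝ) (L : ℕ)
    (i j : Fin n) :
    (M ^ L) i j = ∑ w : Fin (L + 1) → Fin n,
      if w 0 = i ∧ w (Fin.last L) = j then ∏ t : Fin L, M (w t.castSucc) (w t.succ) else 0 := by
  induction L generalizing i with
  | zero =>
    rw [pow_zero, Matrix.one_apply, ← (Equiv.funUnique (Fin 1) (Fin n)).symm.sum_comp]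
    simp only [Finset.univ_eq_empty, Finset.prod_empty, Equiv.funUnique_symm_apply, uniqueElim_const,
      ite_and]
    simp
  | succ L ih =>
    rw [pow_succ', Matrix.mul_apply, ← (Fin.consEquiv fun _ => Fin n).sum_comp,
      Fintype.sum_prod_type]
    have h1 : ∀ a : Fin n, ∀ w : Fin (L + 1) → Fin n,
        (if (Fin.consEquiv fun _ => Fin n) (a, w) 0 = i ∧
            (Fin.consEquiv fun _ => Fin n) (a, w) (Fin.last (L + 1)) = j then
          ∏ t : Fin (L + 1), M ((Fin.consEquiv fun _ => Fin n) (a, w) t.castSucc)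
            ((Fin.consEquiv fun _ => Fin n) (a, w) t.succ) else 0) =
        if a = i then (if w (Fin.last L) = j then
          M a (w 0) * ∏ t : Fin L, M (w t.castSucc) (w t.succ) else 0) else 0 := by
      intro a w
      rw [ite_and, Fin.prod_univ_succ]
      simp [Fin.consEquiv, ← Fin.succ_last]
    simp_rw [h1]
    rw [Finset.sum_comm]
    simp_rw [Finset.sum_ite_eq', Finset.mem_univ, if_true, ih, Finset.mul_sum]
    rw [Finset.sum_comm]
    refine Finset.sum_congr rfl fun w _ => ?_
    rw [Finset.sum_eq_single (w 0)]
    · simp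
    · intro b _ hb
      simp [hb.symm]
    · simp

theorem Matrix.trace_pow_eq_sum_walks {n : ℕ} (M : Matrix (Fin n) (Fin n) ℝ) (L : ℕ) :
    (M ^ L).trace = ∑ w : Fin (L + 1) → Fin n with w (Fin.last L) = w 0,
      ∏ t : Fin L, M (w t.castSucc) (w t.succ) := by
  simp_rw [Matrix.trace, Matrix.diag, Matrix.pow_apply_eq_sum_walks]
  rw [Finset.sum_comm, Finset.sum_filter]
  refine Finset.sum_congr rfl fun w _ => ?_
  simp [ite_and]

/-- The trace of an even power is a sum of nonnegative powers of eigenvalues, hence dominates each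
of them. -/
theorem Matrix.norm_toEuclideanLin_pow_le_trace {n : ℕ} {M : Matrix (Fin n) (Fin n) ℝ}
    (hM : M.IsHermitian) (k : ℕ) {η : ℝ} (hη : 0 ≤ η) (hk : k ≠ 0)
    (h : (M ^ (2 * k)).trace ≤ η ^ (2 * k)) (x : EuclideanSpace ℝ (Fin n)) :
    ‖Matrix.toEuclideanLin M x‖ ≤ η * ‖x‖ := by
  have hT := Matrix.isSymmetric_toEuclideanLin_iff.mpr hM
  have hn : finrank ℝ (EuclideanSpace ℝ (Fin n)) = n := by simp
  set T := Matrix.toEuclideanLin M with hTdef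
  set b := hT.eigenvectorBasis hn with hb
  have hpow : ∀ (j : ℕ) (i : Fin n), (T ^ j) (b i) = (hT.eigenvalues hn i) ^ j • b i := by
    intro j i
    induction j with
    | zero => simp
    | succ j ih =>
      rw [pow_succ', Module.End.mul_apply, ih, map_smul, hT.apply_eigenvectorBasis, smul_smul,
        pow_succ]
      rfl
  have htr : (M ^ (2 * k)).trace = ∑ i, (hT.eigenvalues hn i) ^ (2 * k) := by
    have h1 : LinearMap.trace ℝ _ (Matrix.toEuclideanLin (M ^ (2 * k))) = (M ^ (2 * k)).trace := by
      rw [Matrix.toEuclideanLin_eq_toLin_orthonormal, Matrix.trace_toLin_eq]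
    rw [← h1, Matrix.toLpLin_pow, LinearMap.trace_eq_sum_inner _ b]
    refine Finset.sum_congr rfl fun i _ => ?_
    rw [hpow, inner_smul_right, b.inner_eq_one, mul_one]
  have hle : ∀ i, |hT.eigenvalues hn i| ≤ η := by
    intro i
    refine le_of_pow_le_pow_left₀ (n := 2 * k) (by omega) hη ?_
    rw [(even_two_mul k).pow_abs]
    refine le_trans ?_ (htr ▸ h)
    exact Finset.single_le_sum (f := fun i => (hT.eigenvalues hn i) ^ (2 * k))
      (fun i _ => (even_two_mul k).pow_nonneg _) (Finset.mem_univ i)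
  refine abs_le_of_sq_le_sq' ?_ (by positivity) |>.2
  -- The identity for `‖T x‖ ^ 2` needs no sign condition on `σ`, so a diagonalization with signed
  -- eigenvalues can be used.
  rw [norm_sq_map_of_svd (u := b) (w := b) (σ := hT.eigenvalues hn)
    (fun i => hT.apply_eigenvectorBasis hn i), mul_pow, b.norm_sq_eq_sum_inner_sq, Finset.mul_sum]
  refine Finset.sum_le_sum fun i _ => ?_
  have := sq_le_sq.2 ((hle i).trans (le_abs_self η))
  gcongr

end TracePowers

/-! ### Weighted enumeration of walks by their edge sets -/

section WalkCounting

/-- The undirected edge joining `i` and `j`, as an ordered pair. -/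
def undirectedEdge {n : ℕ} (i j : Fin n) : {p : Fin n × Fin n // p.1 ≤ p.2} :=
  ⟨(min i j, max i j), min_le_max⟩

theorem undirectedEdge_eq_iff {n : ℕ} {i j k l : Fin n} :
    undirectedEdge i j = undirectedEdge k l ↔ (i = k ∧ j = l) ∨ (i = l ∧ j = k) := by
  simp only [undirectedEdge, Subtype.mk.injEq, Prod.mk.injEq]
  constructor
  · rintro ⟨h1, h2⟩
    rcases le_total i j with h | h <;> rcases le_total k l with h' | h' <;> simp_all
  · rintro (⟨rfl, rfl⟩ | ⟨rfl, rfl⟩)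
    · simp
    · simp [min_comm, max_comm]

/-- The set of undirected edges traversed by a walk. -/
def walkEdges {n L : ℕ} (w : Fin (L + 1) → Fin n) : Finset {p : Fin n × Fin n // p.1 ≤ p.2} :=
  Finset.univ.image fun t : Fin L => undirectedEdge (w t.castSucc) (w t.succ)

theorem walkEdges_cons {n L : ℕ} (i : Fin n) (w : Fin (L + 1) → Fin n) :
    walkEdges (Fin.cons i w : Fin (L + 2) → Fin n) =
      insert (undirectedEdge i (w 0)) (walkEdges w) := by
  ext e
  simp [walkEdges, Fin.exists_fin_succ, eq_comm]

theorem card_walkEdges_le {n L : ℕ} (w : Fin (L + 1) → Fin n) : (walkEdges w).card ≤ L := by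
  exact Finset.card_image_le.trans_eq (by simp)

/-- Prepend one vertex at a time. A new edge costs its weight, in total at most `D`; an old edge is
free, but there are at most `N` of them. Keeping `N` separate from `L` fixes the base of the power
during the induction. -/
theorem sum_walks_prod_edges_le {n : ℕ} (q : {p : Fin n × Fin n // p.1 ≤ p.2} → ℝ)
    (hq : ∀ e, 0 ≤ q e) {D : ℝ} (hD : 0 ≤ D)
    (hqD : ∀ j, ∑ i, q (undirectedEdge i j) ≤ D) (N L : ℕ) (hL : L ≤ N) :
    ∑ w : Fin (L + 1) → Fin n, ∏ e ∈ walkEdges w, q e ≤ n * (D + N) ^ L := by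
  induction L with
  | zero => simp [walkEdges]
  | succ L ih =>
    have ih := ih (by omega)
    rw [← (Fin.consEquiv fun _ => Fin n).sum_comp, Fintype.sum_prod_type, Finset.sum_comm]
    have h1 : ∀ w : Fin (L + 1) → Fin n,
        ∑ i, ∏ e ∈ walkEdges ((Fin.consEquiv fun _ => Fin n) (i, w)), q e ≤
          (D + N) * ∏ e ∈ walkEdges w, q e := by
      intro w
      have hF : 0 ≤ ∏ e ∈ walkEdges w, q e := Finset.prod_nonneg fun e _ => hq e
      have h2 : ∀ i, ∏ e ∈ walkEdges ((Fin.consEquiv fun _ => Fin n) (i, w)), q e ≤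
          (q (undirectedEdge i (w 0)) + if undirectedEdge i (w 0) ∈ walkEdges w then 1 else 0) *
            ∏ e ∈ walkEdges w, q e := by
        intro i
        change ∏ e ∈ walkEdges (Fin.cons i w : Fin (L + 2) → Fin n), q e ≤ _
        rw [walkEdges_cons]
        split_ifs with hi
        · rw [Finset.insert_eq_of_mem hi]
          have := mul_nonneg (hq (undirectedEdge i (w 0))) hF
          linarith
        · rw [Finset.prod_insert hi, add_zero]
      refine (Finset.sum_le_sum fun i _ => h2 i).trans ?_
      rw [← Finset.sum_mul, Finset.sum_add_distrib]
      refine mul_le_mul_of_nonneg_right (add_le_add (hqD _) ?_) hF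
      rw [Finset.sum_boole]
      -- An edge through `w 0` determines its other endpoint, so reused edges inject into `walkEdges
      -- w`.
      have h3 : (Finset.univ.filter fun i => undirectedEdge i (w 0) ∈ walkEdges w).card ≤
          (walkEdges w).card := by
        refine Finset.card_le_card_of_injOn (fun i => undirectedEdge i (w 0)) (fun i hi => ?_) ?_
        · simpa using hi
        · intro i _ j _ hij
          rcases undirectedEdge_eq_iff.1 hij with h | h
          · exact h.1
          · exact h.1.trans h.2
      exact_mod_cast h3.trans ((card_walkEdges_le w).trans (by omega))
    refine (Finset.sum_le_sum fun w _ => h1 w).trans ?_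
    rw [← Finset.mul_sum, pow_succ]
    calc (D + N) * ∑ w : Fin (L + 1) → Fin n, ∏ e ∈ walkEdges w, q e
        ≤ (D + N) * (n * (D + N) ^ L) := by gcongr
      _ = _ := by ring

end WalkCounting

/-! ### Moments of the centred adjacency matrix -/

section Moments

variable {n : ℕ} {Ω : Type*} [MeasurableSpace Ω] {μ : Measure Ω}
  {P : Matrix (Fin n) (Fin n) ℝ} {A : Ω → Matrix (Fin n) (Fin n) ℝ}

namespace IsIERM

theorem apply_undirectedEdge (h : IsIERM μ P A) (ω : Ω) (i j : Fin n) :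
    (A ω - P) (undirectedEdge i j).1.1 (undirectedEdge i j).1.2 = (A ω - P) i j := by
  rcases le_total i j with hij | hij
  · simp [undirectedEdge, hij]
  · simp [undirectedEdge, hij, (h.adj_symm ω).apply i j, h.prob_symm.apply i j]

theorem prob_undirectedEdge (h : IsIERM μ P A) (i j : Fin n) :
    P (undirectedEdge i j).1.1 (undirectedEdge i j).1.2 = P i j := by
  rcases le_total i j with hij | hij
  · simp [undirectedEdge, hij]
  · simp [undirectedEdge, hij, h.prob_symm.apply i j]

theorem abs_sub_le_one (h : IsIERM μ P A) (ω : Ω) (i j : Fin n) : |(A ω - P) i j| ≤ 1 := by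
  have := h.prob_mem i j
  rw [Matrix.sub_apply, abs_le]
  rcases h.adj_binary ω i j with h0 | h0 <;> rw [h0] <;> constructor <;> linarith [this.1, this.2]

theorem measurable_sub (h : IsIERM μ P A) (i j : Fin n) : Measurable fun ω => (A ω - P) i j :=
  (h.measurable_entry i j).sub_const _

variable [IsProbabilityMeasure μ]

theorem integral_pow (h : IsIERM μ P A) (i j : Fin n) (m : ℕ) :
    ∫ ω, (A ω - P) i j ^ m ∂μ = P i j * (1 - P i j) ^ m + (1 - P i j) * (-P i j) ^ m := by
  have h1 : ∀ ω, (A ω - P) i j ^ m = (-P i j) ^ m +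
      {ω | A ω i j = 1}.indicator (fun _ => (1 - P i j) ^ m - (-P i j) ^ m) ω := by
    intro ω
    rw [Matrix.sub_apply]
    rcases h.adj_binary ω i j with h0 | h0
    · rw [Set.indicator_of_notMem (by simp [h0])]
      simp [h0]
    · rw [Set.indicator_of_mem (by simp [h0])]
      simp [h0]
  have hms : MeasurableSet {ω | A ω i j = 1} := h.measurable_entry i j (measurableSet_singleton 1)
  simp_rw [h1]
  rw [integral_add (integrable_const _) ((integrable_const _).indicator hms),
    integral_indicator_const _ hms, measureReal_def, h.bernoulli,
    ENNReal.toReal_ofReal (h.prob_mem i j).1]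
  simp
  ring

/-- The first moment vanishes and every higher one is at most `P i j ≤ P i j * s ^ (m - 2)`. In this
form the powers of `s` multiply to `s ^ L` along a walk, so edge multiplicities disappear from the
count. -/
theorem abs_integral_pow_le (h : IsIERM μ P A) (i j : Fin n) {s : ℝ} (hs : 1 ≤ s) (m : ℕ) :
    |∫ ω, (A ω - P) i j ^ m ∂μ| ≤ (if m = 0 then 1 else P i j / s ^ 2) * s ^ m := by
  rw [h.integral_pow]
  obtain ⟨hp0, hp1⟩ := h.prob_mem i j
  set p := P i j
  have hq0 : 0 ≤ 1 - p := by linarith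
  match m with
  | 0 => simp
  | 1 =>
    have : p * (1 - p) ^ 1 + (1 - p) * (-p) ^ 1 = 0 := by ring
    rw [this]
    simp
    positivity
  | m + 2 =>
    have h1 : |p * (1 - p) ^ (m + 2) + (1 - p) * (-p) ^ (m + 2)| ≤ p := by
      refine (abs_add_le _ _).trans ?_
      rw [abs_mul, abs_mul, abs_pow, abs_pow, abs_neg, abs_of_nonneg hp0, abs_of_nonneg hq0]
      have h2 : (1 - p) ^ (m + 2) ≤ 1 - p := pow_le_of_le_one hq0 (by linarith) (by omega)
      have h3 : p ^ (m + 2) ≤ p ^ 2 := pow_le_pow_of_le_one hp0 hp1 (by omega)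
      nlinarith [mul_le_mul_of_nonneg_left h2 hp0, mul_le_mul_of_nonneg_left h3 hq0,
        pow_nonneg hp0 3]
    refine h1.trans ?_
    have hs0 : 0 < s := by linarith
    rw [if_neg (by omega), pow_add, mul_comm (s ^ m), ← mul_assoc, div_mul_cancel₀ _ (by positivity)]
    exact le_mul_of_one_le_right hp0 (one_le_pow₀ hs)

theorem integrable_prod (h : IsIERM μ P A) {ι : Type*} (S : Finset ι) (f g : ι → Fin n) :
    Integrable (fun ω => ∏ t ∈ S, (A ω - P) (f t) (g t)) μ := by
  refine Integrable.of_bound (C := 1)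
    (Finset.measurable_prod _ fun t _ => h.measurable_sub _ _).aestronglyMeasurable
    (ae_of_all _ fun ω => ?_)
  rw [Real.norm_eq_abs, Finset.abs_prod]
  exact Finset.prod_le_one (fun _ _ => abs_nonneg _) fun _ _ => h.abs_sub_le_one _ _ _

omit [IsProbabilityMeasure μ] in
-- Group the factors by undirected edge and use independence; an edge that never occurs contributes
-- the zeroth moment `1`.
theorem integral_prod_eq (h : IsIERM μ P A) {ι : Type*} [Fintype ι] (f g : ι → Fin n) :
    ∫ ω, ∏ t, (A ω - P) (f t) (g t) ∂μ =
      ∏ e : {p : Fin n × Fin n // p.1 ≤ p.2}, ∫ ω, (A ω - P) e.1.1 e.1.2 ^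
        (Finset.univ.filter fun t => undirectedEdge (f t) (g t) = e).card ∂μ := by
  refine Eq.trans ?_ (h.indep.integral_fun_prod_comp
    (f := fun e x => (x - P e.1.1 e.1.2) ^
      (Finset.univ.filter fun t => undirectedEdge (f t) (g t) = e).card)
    (fun e => (h.measurable_entry _ _).aemeasurable)
    (fun e => (Measurable.pow_const (measurable_id.sub_const _) _).aestronglyMeasurable))
  congr 1 with ω
  rw [← Finset.prod_fiberwise Finset.univ (fun t => undirectedEdge (f t) (g t))]
  refine Finset.prod_congr rfl fun e _ => ?_
  rw [← Finset.prod_const]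
  refine Finset.prod_congr rfl fun t ht => ?_
  rw [← h.apply_undirectedEdge, (Finset.mem_filter.1 ht).2]
  rfl

theorem integral_walk_le (h : IsIERM μ P A) {s : ℝ} (hs : 1 ≤ s) {L : ℕ}
    (w : Fin (L + 1) → Fin n) :
    ∫ ω, ∏ t : Fin L, (A ω - P) (w t.castSucc) (w t.succ) ∂μ ≤
      s ^ L * ∏ e ∈ walkEdges w, (P e.1.1 e.1.2 / s ^ 2) := by
  refine (le_abs_self _).trans ?_
  rw [h.integral_prod_eq, Finset.abs_prod]
  refine (Finset.prod_le_prod (fun _ _ => abs_nonneg _)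
    fun e _ => h.abs_integral_pow_le e.1.1 e.1.2 hs _).trans_eq ?_
  rw [Finset.prod_mul_distrib, Finset.prod_pow_eq_pow_sum, mul_comm]
  congr 1
  · congr 1
    simpa using (Finset.card_eq_sum_card_fiberwise (s := (Finset.univ : Finset (Fin L)))
      (f := fun t => undirectedEdge (w t.castSucc) (w t.succ)) (t := Finset.univ)
      (fun _ _ => Finset.mem_coe.2 (Finset.mem_univ _))).symm
  · rw [← Finset.prod_subset (Finset.subset_univ (walkEdges w))]
    · refine Finset.prod_congr rfl fun e he => if_neg ?_
      obtain ⟨t, _, ht⟩ := Finset.mem_image.1 he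
      rw [Finset.card_eq_zero, Finset.filter_eq_empty_iff]
      exact fun h' => h' (Finset.mem_univ t) ht
    · intro e _ he
      refine if_pos ?_
      rw [Finset.card_eq_zero, Finset.filter_eq_empty_iff]
      exact fun t _ ht => he (Finset.mem_image.2 ⟨t, Finset.mem_univ t, ht⟩)

theorem integrable_trace_pow (h : IsIERM μ P A) (L : ℕ) :
    Integrable (fun ω => ((A ω - P) ^ L).trace) μ := by
  simp_rw [Matrix.trace_pow_eq_sum_walks]
  exact integrable_finsetSum _ fun w _ => h.integrable_prod _ _ _

theorem integral_trace_pow_le (h : IsIERM μ P A) {s D : ℝ} (hs : 1 ≤ s) (hD : 0 ≤ D)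
    (hPD : ∀ i, ∑ j, P i j ≤ D) (L : ℕ) :
    ∫ ω, ((A ω - P) ^ L).trace ∂μ ≤ n * (s * (D / s ^ 2 + L)) ^ L := by
  have hs0 : 0 < s := by linarith
  have hq : ∀ e : {p : Fin n × Fin n // p.1 ≤ p.2}, 0 ≤ P e.1.1 e.1.2 / s ^ 2 := fun e =>
    div_nonneg (h.prob_mem _ _).1 (by positivity)
  simp_rw [Matrix.trace_pow_eq_sum_walks]
  rw [integral_finsetSum _ fun w _ => h.integrable_prod _ _ _]
  calc _ ≤ ∑ w : Fin (L + 1) → Fin n with w (Fin.last L) = w 0,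
        s ^ L * ∏ e ∈ walkEdges w, (P e.1.1 e.1.2 / s ^ 2) :=
        Finset.sum_le_sum fun w _ => h.integral_walk_le hs w
    _ ≤ ∑ w : Fin (L + 1) → Fin n, s ^ L * ∏ e ∈ walkEdges w, (P e.1.1 e.1.2 / s ^ 2) :=
        -- The closing condition on walks is dropped; this costs nothing that matters for a bound
        -- with prefactor `n`.
        Finset.sum_le_sum_of_subset_of_nonneg (Finset.filter_subset _ _) fun w _ _ =>
          mul_nonneg (by positivity) (Finset.prod_nonneg fun e _ => hq e)
    _ ≤ s ^ L * (n * (D / s ^ 2 + L) ^ L) := by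
        rw [← Finset.mul_sum]
        gcongr
        refine sum_walks_prod_edges_le _ hq (by positivity) (fun j => ?_) L L le_rfl
        simp_rw [h.prob_undirectedEdge]
        rw [← Finset.sum_div]
        gcongr
        simpa [h.prob_symm.apply] using hPD j
    _ = _ := by rw [mul_pow]; ring

theorem integral_mul_eq (h : IsIERM μ P A) (i j k l : Fin n) :
    ∫ ω, (A ω - P) i j * (A ω - P) k l ∂μ =
      if undirectedEdge i j = undirectedEdge k l then P i j * (1 - P i j) else 0 := by
  split_ifs with he
  · have : ∀ ω, (A ω - P) i j * (A ω - P) k l = (A ω - P) i j ^ 2 := fun ω => by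
      rw [← h.apply_undirectedEdge ω k l, ← he, h.apply_undirectedEdge, sq]
    simp_rw [this]
    rw [h.integral_pow]
    ring
  · have hind := h.indep.indepFun he
    have hm : Measurable fun x : ℝ => x - P i j := measurable_id.sub_const _
    have hm' : Measurable fun x : ℝ => x - P k l := measurable_id.sub_const _
    have hind' := hind.comp hm hm'
    have h1 : ∀ ω a b, A ω (undirectedEdge a b).1.1 (undirectedEdge a b).1.2 = A ω a b := by
      intro ω a b
      have := h.apply_undirectedEdge ω a b
      simpa [h.prob_undirectedEdge] using this
    have h2 : ∀ a b, ∫ ω, (A ω - P) a b ∂μ = 0 := fun a b => by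
      have := h.integral_pow a b 1
      simp only [pow_one] at this
      rw [this]
      ring
    have h3 := hind'.integral_fun_mul_eq_mul_integral
      (hm.comp (h.measurable_entry _ _)).aestronglyMeasurable
      (hm'.comp (h.measurable_entry _ _)).aestronglyMeasurable
    simp only [Function.comp_apply, h1] at h3
    simp only [Matrix.sub_apply] at h2 ⊢
    rw [h3]
    simp [h2]

theorem integrable_mul (h : IsIERM μ P A) (i j k l : Fin n) :
    Integrable (fun ω => (A ω - P) i j * (A ω - P) k l) μ := by
  simpa [Fin.prod_univ_two] using h.integrable_prod Finset.univ ![i, k] ![j, l]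

theorem _root_.Matrix.inner_toEuclideanLin (M : Matrix (Fin n) (Fin n) ℝ)
    (w u : EuclideanSpace ℝ (Fin n)) :
    inner ℝ w (Matrix.toEuclideanLin M u) = ∑ p : Fin n × Fin n, w p.1 * u p.2 * M p.1 p.2 := by
  rw [Fintype.sum_prod_type, PiLp.inner_apply]
  refine Finset.sum_congr rfl fun i _ => ?_
  rw [Matrix.toLpLin_apply]
  simp only [Matrix.mulVec, dotProduct, RCLike.inner_apply, conj_trivial, Finset.sum_mul]
  refine Finset.sum_congr rfl fun j _ => ?_
  ring

theorem _root_.Matrix.inner_toEuclideanLin_sq (M : Matrix (Fin n) (Fin n) ℝ)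
    (w u : EuclideanSpace ℝ (Fin n)) :
    inner ℝ w (Matrix.toEuclideanLin M u) ^ 2 =
      ∑ p : Fin n × Fin n, ∑ q : Fin n × Fin n,
        w p.1 * u p.2 * (w q.1 * u q.2) * (M p.1 p.2 * M q.1 q.2) := by
  rw [Matrix.inner_toEuclideanLin, sq, Finset.sum_mul_sum]
  refine Finset.sum_congr rfl fun p _ => Finset.sum_congr rfl fun q _ => ?_
  ring

theorem _root_.Matrix.norm_sq_toEuclideanLin (M : Matrix (Fin n) (Fin n) ℝ)
    (u : EuclideanSpace ℝ (Fin n)) :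
    ‖Matrix.toEuclideanLin M u‖ ^ 2 =
      ∑ i, ∑ j, ∑ k, u j * u k * (M i j * M i k) := by
  rw [EuclideanSpace.real_norm_sq_eq]
  refine Finset.sum_congr rfl fun i _ => ?_
  rw [Matrix.toLpLin_apply]
  simp only [Matrix.mulVec, dotProduct, sq, Finset.sum_mul_sum]
  refine Finset.sum_congr rfl fun j _ => Finset.sum_congr rfl fun k _ => ?_
  ring

theorem integrable_inner_sq (h : IsIERM μ P A) (w u : EuclideanSpace ℝ (Fin n)) :
    Integrable (fun ω => inner ℝ w (Matrix.toEuclideanLin (A ω - P) u) ^ 2) μ := by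
  simp_rw [Matrix.inner_toEuclideanLin_sq]
  exact integrable_finsetSum _ fun p _ => integrable_finsetSum _ fun q _ =>
    (h.integrable_mul _ _ _ _).const_mul _

/-- Two entries correlate only if they are equal or transposed. The transposed pairs are handled by
`2ab ≤ a² + b²` and account for the factor `2`. -/
theorem integral_inner_sq_le (h : IsIERM μ P A) (w u : EuclideanSpace ℝ (Fin n)) :
    ∫ ω, inner ℝ w (Matrix.toEuclideanLin (A ω - P) u) ^ 2 ∂μ ≤ 2 * (‖w‖ ^ 2 * ‖u‖ ^ 2) := by
  simp_rw [Matrix.inner_toEuclideanLin_sq]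
  set a : Fin n × Fin n → ℝ := fun p => w p.1 * u p.2 with ha
  have hsum : ∑ p, a p ^ 2 = ‖w‖ ^ 2 * ‖u‖ ^ 2 := by
    rw [Fintype.sum_prod_type, EuclideanSpace.real_norm_sq_eq, EuclideanSpace.real_norm_sq_eq,
      Finset.sum_mul_sum]
    simp [ha, mul_pow]
  have hswap : ∑ p : Fin n × Fin n, a p.swap ^ 2 = ∑ p, a p ^ 2 :=
    (Equiv.prodComm (Fin n) (Fin n)).sum_comp fun p => a p ^ 2
  rw [integral_finsetSum _ fun p _ => integrable_finsetSum _ fun q _ =>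
    (h.integrable_mul _ _ _ _).const_mul _]
  have h1 : ∀ p : Fin n × Fin n, ∫ ω, ∑ q : Fin n × Fin n, (w p.1 * u p.2 * (w q.1 * u q.2)) *
      ((A ω - P) p.1 p.2 * (A ω - P) q.1 q.2) ∂μ ≤ a p ^ 2 + (a p ^ 2 + a p.swap ^ 2) / 2 := by
    intro p
    rw [integral_finsetSum _ fun q _ => (h.integrable_mul _ _ _ _).const_mul _]
    have h2 : ∀ q : Fin n × Fin n, ∫ ω, (w p.1 * u p.2 * (w q.1 * u q.2)) *
        ((A ω - P) p.1 p.2 * (A ω - P) q.1 q.2) ∂μ ≤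
          (if q = p then |a p * a q| else 0) + if q = p.swap then |a p * a q| else 0 := by
      intro q
      rw [integral_const_mul, h.integral_mul_eq]
      obtain ⟨hp0, hp1⟩ := h.prob_mem p.1 p.2
      split_ifs with h3 h4 h5 h6
      · refine le_trans ?_ (le_add_of_nonneg_right (abs_nonneg _))
        refine (le_abs_self _).trans ?_
        rw [abs_mul, abs_of_nonneg (mul_nonneg hp0 (by linarith))]
        exact mul_le_of_le_one_right (abs_nonneg _) (by nlinarith)
      · rw [add_zero]
        refine (le_abs_self _).trans ?_
        rw [abs_mul, abs_of_nonneg (mul_nonneg hp0 (by linarith))]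
        exact mul_le_of_le_one_right (abs_nonneg _) (by nlinarith)
      · rw [zero_add]
        refine (le_abs_self _).trans ?_
        rw [abs_mul, abs_of_nonneg (mul_nonneg hp0 (by linarith))]
        exact mul_le_of_le_one_right (abs_nonneg _) (by nlinarith)
      · exfalso
        rcases undirectedEdge_eq_iff.1 h3 with ⟨h7, h8⟩ | ⟨h7, h8⟩
        · exact h4 (Prod.ext h7.symm h8.symm)
        · exact h6 (Prod.ext h8.symm h7.symm)
      all_goals rw [mul_zero]; positivity
    refine (Finset.sum_le_sum fun q _ => h2 q).trans ?_
    rw [Finset.sum_add_distrib, Finset.sum_ite_eq', Finset.sum_ite_eq']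
    simp only [Finset.mem_univ, if_true]
    rw [abs_mul_self, abs_mul, ← sq, ← sq_abs (a p.swap), ← sq_abs (a p)]
    have := two_mul_le_add_sq |a p| |a p.swap|
    linarith
  refine (Finset.sum_le_sum fun p _ => h1 p).trans_eq ?_
  rw [Finset.sum_add_distrib, ← Finset.sum_div, Finset.sum_add_distrib, hswap, hsum]
  ring

theorem integrable_norm_sq (h : IsIERM μ P A) (u : EuclideanSpace ℝ (Fin n)) :
    Integrable (fun ω => ‖Matrix.toEuclideanLin (A ω - P) u‖ ^ 2) μ := by
  simp_rw [Matrix.norm_sq_toEuclideanLin]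
  exact integrable_finsetSum _ fun i _ => integrable_finsetSum _ fun j _ =>
    integrable_finsetSum _ fun k _ => (h.integrable_mul _ _ _ _).const_mul _

/-- Distinct entries of one row belong to distinct edges, so cross terms vanish and only variances,
at most `P i j`, remain. -/
theorem integral_norm_sq_le (h : IsIERM μ P A) {D : ℝ} (hPD : ∀ i, ∑ j, P i j ≤ D)
    (u : EuclideanSpace ℝ (Fin n)) :
    ∫ ω, ‖Matrix.toEuclideanLin (A ω - P) u‖ ^ 2 ∂μ ≤ D * ‖u‖ ^ 2 := by
  simp_rw [Matrix.norm_sq_toEuclideanLin]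
  rw [integral_finsetSum _ fun i _ => integrable_finsetSum _ fun j _ =>
    integrable_finsetSum _ fun k _ => (h.integrable_mul _ _ _ _).const_mul _]
  have h1 : ∀ i, ∫ ω, ∑ j, ∑ k, u j * u k * ((A ω - P) i j * (A ω - P) i k) ∂μ ≤
      ∑ j, u j ^ 2 * P j i := by
    intro i
    rw [integral_finsetSum _ fun j _ =>
      integrable_finsetSum _ fun k _ => (h.integrable_mul _ _ _ _).const_mul _]
    refine Finset.sum_le_sum fun j _ => ?_
    rw [integral_finsetSum _ fun k _ => (h.integrable_mul _ _ _ _).const_mul _,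
      Finset.sum_eq_single j]
    · rw [integral_const_mul, h.integral_mul_eq, if_pos rfl, ← sq, ← h.prob_symm.apply i j]
      obtain ⟨hp0, hp1⟩ := h.prob_mem j i
      gcongr
      nlinarith
    · intro k _ hkj
      rw [integral_const_mul, h.integral_mul_eq, if_neg, mul_zero]
      intro he
      rcases undirectedEdge_eq_iff.1 he with h' | h'
      · exact hkj h'.2.symm
      · exact hkj (h'.1.symm.trans h'.2.symm)
    · simp
  refine (Finset.sum_le_sum fun i _ => h1 i).trans ?_
  rw [Finset.sum_comm, EuclideanSpace.real_norm_sq_eq, Finset.mul_sum]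
  refine Finset.sum_le_sum fun j _ => ?_
  rw [← Finset.mul_sum, mul_comm]
  gcongr
  exact hPD j

end IsIERM

end Moments

/-! ### From moments to high probability -/

section HighProbability

theorem measure_lt_le_ofReal_div {Ω : Type*} [MeasurableSpace Ω] {μ : Measure Ω}
    [IsFiniteMeasure μ] {f : Ω → ℝ} (hf0 : ∀ ω, 0 ≤ f ω) (hf : Integrable f μ) {M t : ℝ}
    (ht : 0 < t) (hM : ∫ ω, f ω ∂μ ≤ M) : μ {ω | t < f ω} ≤ ENNReal.ofReal (M / t) := by
  have h1 := mul_meas_ge_le_integral_of_nonneg (ae_of_all _ hf0) hf t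
  have h2 : μ.real {ω | t ≤ f ω} ≤ M / t := by
    rw [le_div_iff₀ ht, mul_comm]
    exact h1.trans hM
  have h3 : {ω | t < f ω} ⊆ {ω | t ≤ f ω} := fun ω (hω : t < f ω) => hω.le
  refine (measure_mono h3).trans ?_
  rw [← ofReal_measureReal]
  exact ENNReal.ofReal_le_ofReal h2

/-- Subadditivity on a set and its complement suffices, so the events need not be shown measurable.
-/
theorem tendsto_measure_one_of_compl_le {Ω : ℕ → Type*} [∀ n, MeasurableSpace (Ω n)]
    {μ : ∀ n, Measure (Ω n)} [∀ n, IsProbabilityMeasure (μ n)] {S : ∀ n, Set (Ω n)} {b : ℕ → ℝ}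
    (hb : Tendsto b atTop (𝓝 0)) (h : ∀ᶠ n in atTop, μ n (S n)ᶜ ≤ ENNReal.ofReal (b n)) :
    Tendsto (fun n => μ n (S n)) atTop (𝓝 1) := by
  have h1 : Tendsto (fun n => 1 - ENNReal.ofReal (b n)) atTop (𝓝 1) := by
    have := ENNReal.Tendsto.sub (tendsto_const_nhds (x := (1 : ENNReal)) (f := atTop))
      (ENNReal.tendsto_ofReal hb) (Or.inl ENNReal.one_ne_top)
    simpa using this
  refine tendsto_of_tendsto_of_tendsto_of_le_of_le' h1 tendsto_const_nhds ?_
    (Eventually.of_forall fun n => prob_le_one)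
  filter_upwards [h] with n hn
  rw [tsub_le_iff_right, ← measure_univ (μ := μ n), ← Set.union_compl_self (S n)]
  exact (measure_union_le _ _).trans (by gcongr)

theorem tendsto_measure_one_mono {Ω : ℕ → Type*} [∀ n, MeasurableSpace (Ω n)]
    {μ : ∀ n, Measure (Ω n)} [∀ n, IsProbabilityMeasure (μ n)] {S T : ∀ n, Set (Ω n)}
    (hS : Tendsto (fun n => μ n (S n)) atTop (𝓝 1)) (h : ∀ᶠ n in atTop, S n ⊆ T n) :
    Tendsto (fun n => μ n (T n)) atTop (𝓝 1) :=
  tendsto_of_tendsto_of_tendsto_of_le_of_le' hS tendsto_const_nhds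
    (h.mono fun _ hn => measure_mono hn) (Eventually.of_forall fun _ => prob_le_one)

/-- The event that the noise `X` acts weakly on the test vectors `f` and is small in operator
norm. -/
def IsTameNoise {n : ℕ} {κ : Type*} (f : κ → EuclideanSpace ℝ (Fin n)) (t r η : ℝ)
    (X : Matrix (Fin n) (Fin n) ℝ) : Prop :=
  (∀ a b, |inner ℝ (f a) (Matrix.toEuclideanLin X (f b))| ≤ t) ∧
    (∀ a, ‖Matrix.toEuclideanLin X (f a)‖ ^ 2 ≤ r) ∧
    ∀ x, ‖Matrix.toEuclideanLin X x‖ ≤ η * ‖x‖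

theorem sum_le_maxExpectedDegree {n : ℕ} (P : Matrix (Fin n) (Fin n) ℝ) (i : Fin n) :
    ∑ j, P i j ≤ maxExpectedDegree P :=
  le_ciSup (f := fun i => ∑ j, P i j) (Set.finite_range _).bddAbove i

theorem IsIERM.isHermitian_sub {n : ℕ} {Ω : Type*} [MeasurableSpace Ω] {μ : Measure Ω}
    {P : Matrix (Fin n) (Fin n) ℝ} {A : Ω → Matrix (Fin n) (Fin n) ℝ} (h : IsIERM μ P A) (ω : Ω) :
    (A ω - P).IsHermitian := by
  rw [Matrix.IsHermitian, Matrix.conjTranspose_eq_transpose_of_trivial]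
  exact (h.adj_symm ω).sub h.prob_symm

theorem IsIERM.maxExpectedDegree_nonneg {n : ℕ} {Ω : Type*} [MeasurableSpace Ω] {μ : Measure Ω}
    {P : Matrix (Fin n) (Fin n) ℝ} {A : Ω → Matrix (Fin n) (Fin n) ℝ} (h : IsIERM μ P A) :
    0 ≤ maxExpectedDegree P :=
  Real.iSup_nonneg fun i => Finset.sum_nonneg fun j _ => (h.prob_mem i j).1

theorem IsIERM.measure_not_isTameNoise_le {n : ℕ} {Ω : Type*} [MeasurableSpace Ω] {μ : Measure Ω}
    [IsProbabilityMeasure μ] {P : Matrix (Fin n) (Fin n) ℝ} {A : Ω → Matrix (Fin n) (Fin n) ℝ}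
    (h : IsIERM μ P A) {κ : Type*} [Fintype κ] {f : κ → EuclideanSpace ℝ (Fin n)}
    (hf : ∀ a, ‖f a‖ ≤ 1) {t r η s : ℝ} (ht : 0 < t) (hr : 0 < r) (hη : 0 < η) (hs : 1 ≤ s)
    {k : ℕ} (hk : k ≠ 0) :
    μ {ω | IsTameNoise f t r η (A ω - P)}ᶜ ≤ ENNReal.ofReal (
      Fintype.card κ * (Fintype.card κ * (2 / t ^ 2)) + Fintype.card κ * (maxExpectedDegree P / r) +
      n * (s * (maxExpectedDegree P / s ^ 2 + (2 * k : ℕ))) ^ (2 * k) / η ^ (2 * k)) := by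
  have hD := h.maxExpectedDegree_nonneg
  have hsub : {ω | IsTameNoise f t r η (A ω - P)}ᶜ ⊆
      ((⋃ a, ⋃ b, {ω | t ^ 2 < inner ℝ (f a) (Matrix.toEuclideanLin (A ω - P) (f b)) ^ 2}) ∪
        ⋃ a, {ω | r < ‖Matrix.toEuclideanLin (A ω - P) (f a)‖ ^ 2}) ∪
        {ω | η ^ (2 * k) < ((A ω - P) ^ (2 * k)).trace} := by
    intro ω hω
    by_contra hcon
    simp only [Set.mem_union, Set.mem_iUnion, Set.mem_ofPred_eq, not_or, not_exists, not_lt] at hcon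
    refine hω ⟨fun a b => ?_, hcon.1.2, fun x => ?_⟩
    · exact abs_le_of_sq_le_sq (hcon.1.1 a b) ht.le
    · exact Matrix.norm_toEuclideanLin_pow_le_trace (h.isHermitian_sub ω) k hη.le hk hcon.2 x
  have h1 : ∀ a b, μ {ω | t ^ 2 < inner ℝ (f a) (Matrix.toEuclideanLin (A ω - P) (f b)) ^ 2} ≤
      ENNReal.ofReal (2 / t ^ 2) := fun a b => by
    refine measure_lt_le_ofReal_div (fun ω => sq_nonneg _) (h.integrable_inner_sq _ _)
      (by positivity) ((h.integral_inner_sq_le _ _).trans ?_)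
    have h2 : ‖f a‖ ^ 2 * ‖f b‖ ^ 2 ≤ 1 := mul_le_one₀
      (pow_le_one₀ (norm_nonneg _) (hf a)) (by positivity) (pow_le_one₀ (norm_nonneg _) (hf b))
    linarith
  have h2 : ∀ a, μ {ω | r < ‖Matrix.toEuclideanLin (A ω - P) (f a)‖ ^ 2} ≤
      ENNReal.ofReal (maxExpectedDegree P / r) := fun a => by
    refine measure_lt_le_ofReal_div (fun ω => sq_nonneg _) (h.integrable_norm_sq _) hr
      ((h.integral_norm_sq_le (sum_le_maxExpectedDegree P) _).trans ?_)
    exact mul_le_of_le_one_right hD (pow_le_one₀ (norm_nonneg _) (hf a))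
  have h3 : μ {ω | η ^ (2 * k) < ((A ω - P) ^ (2 * k)).trace} ≤ ENNReal.ofReal
      (n * (s * (maxExpectedDegree P / s ^ 2 + (2 * k : ℕ))) ^ (2 * k) / η ^ (2 * k)) := by
    refine measure_lt_le_ofReal_div (fun ω => ?_) (h.integrable_trace_pow _) (by positivity)
      (h.integral_trace_pow_le hs hD (sum_le_maxExpectedDegree P) _)
    have hH := h.isHermitian_sub ω
    have : ((A ω - P) ^ (2 * k)).PosSemidef := by
      have h4 := Matrix.posSemidef_conjTranspose_mul_self ((A ω - P) ^ k)
      rwa [(hH.pow k).eq, ← pow_add, ← two_mul] at h4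
    exact this.trace_nonneg
  refine (measure_mono hsub).trans ((measure_union_le _ _).trans ?_)
  rw [ENNReal.ofReal_add (by positivity) (by positivity),
    ENNReal.ofReal_add (by positivity) (by positivity)]
  refine add_le_add ((measure_union_le _ _).trans (add_le_add ?_ ?_)) h3
  · refine (measure_iUnion_fintype_le _ _).trans ?_
    rw [ENNReal.ofReal_mul (by positivity), ENNReal.ofReal_natCast]
    refine (Finset.sum_le_card_nsmul _ _ (ENNReal.ofReal (Fintype.card κ * (2 / t ^ 2)))
      fun a _ => ?_).trans_eq (by simp)
    refine (measure_iUnion_fintype_le _ _).trans ?_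
    rw [ENNReal.ofReal_mul (by positivity), ENNReal.ofReal_natCast]
    exact (Finset.sum_le_card_nsmul _ _ _ fun b _ => h1 a b).trans_eq (by simp)
  · refine (measure_iUnion_fintype_le _ _).trans ?_
    rw [ENNReal.ofReal_mul (by positivity), ENNReal.ofReal_natCast]
    exact (Finset.sum_le_card_nsmul _ _ _ fun b _ => h2 b).trans_eq (by simp)

theorem tendsto_log_natCast : Tendsto (fun n : ℕ => Real.log n) atTop atTop :=
  Real.tendsto_log_atTop.comp tendsto_natCast_atTop_atTop

theorem tendsto_measure_isTameNoise {P : ∀ n : ℕ, Matrix (Fin n) (Fin n) ℝ}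
    (hP : (fun n : ℕ => Real.log n ^ 4) =o[atTop] fun n : ℕ => maxExpectedDegree (P n))
    {Ω : ℕ → Type*} [∀ n, MeasurableSpace (Ω n)] {μ : ∀ n, Measure (Ω n)}
    [∀ n, IsProbabilityMeasure (μ n)] {A : ∀ n, Ω n → Matrix (Fin n) (Fin n) ℝ}
    (h : ∀ n, IsIERM (μ n) (P n) (A n)) {κ : Type*} [Fintype κ]
    {f : ∀ n, κ → EuclideanSpace ℝ (Fin n)} (hf : ∀ n a, ‖f n a‖ ≤ 1) {δ ε : ℝ} (hδ : 0 < δ)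
    (hε : 0 < ε) :
    Tendsto (fun n : ℕ => μ n {ω | IsTameNoise (f n) (Real.log n ^ δ)
      (maxExpectedDegree (P n) * Real.log n ^ δ) (ε * maxExpectedDegree (P n)) (A n ω - P n)})
      atTop (𝓝 1) := by
  have hlogδ : Tendsto (fun n : ℕ => Real.log n ^ δ) atTop atTop :=
    (tendsto_rpow_atTop hδ).comp tendsto_log_natCast
  set N : ℝ := (Fintype.card κ : ℝ) with hN
  have hb : Tendsto (fun n : ℕ => N * (N * (2 / (Real.log n ^ δ) ^ 2)) + N * (1 / Real.log n ^ δ) +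
      1 / (n : ℝ)) atTop (𝓝 0) := by
    have h1 : Tendsto (fun n : ℕ => 2 / (Real.log n ^ δ) ^ 2) atTop (𝓝 0) :=
      tendsto_const_nhds.div_atTop ((tendsto_pow_atTop two_ne_zero).comp hlogδ)
    have h2 : Tendsto (fun n : ℕ => 1 / Real.log n ^ δ) atTop (𝓝 0) :=
      tendsto_const_nhds.div_atTop hlogδ
    have := (((h1.const_mul N).const_mul N).add (h2.const_mul N)).add
      tendsto_one_div_atTop_nhds_zero_nat
    simpa using this
  refine tendsto_measure_one_of_compl_le hb ?_
  -- Chosen so that `8 * q = ε / e`. With `s = log n` and `k = ⌈log n⌉`, the base of the moment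
  -- bound is at most `q * D + 4 * (q * D)`, hence below `ε * D / e`. The power `2 * k` then gives
  -- `n * exp (-2 * log n) = 1 / n`.
  set q : ℝ := ε / (8 * Real.exp 1) with hq
  have hq0 : 0 < q := by positivity
  filter_upwards [hP.def hq0, tendsto_log_natCast.eventually_ge_atTop (max 1 (1 / q)),
    eventually_gt_atTop 0] with n hn1 hn2 hn0
  have hlog : 1 ≤ Real.log n := (le_max_left _ _).trans hn2
  have hlogq : 1 / q ≤ Real.log n := (le_max_right _ _).trans hn2
  have hlog0 : 0 < Real.log n := by linarith
  have hD := (h n).maxExpectedDegree_nonneg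
  set D := maxExpectedDegree (P n) with hDdef
  rw [Real.norm_of_nonneg (by positivity), Real.norm_of_nonneg hD] at hn1
  have hDpos : 0 < D := by
    have : 0 < Real.log n ^ 4 := by positivity
    by_contra hcon
    have : D = 0 := le_antisymm (not_lt.1 hcon) hD
    rw [this] at hn1
    linarith
  have hr0 : 0 < Real.log n ^ δ := Real.rpow_pos_of_pos hlog0 δ
  set k := ⌈Real.log n⌉₊ with hkdef
  have hk0 : k ≠ 0 := (Nat.ceil_pos.2 hlog0).ne'
  have hk1 : Real.log n ≤ k := Nat.le_ceil _
  have hk2 : (k : ℝ) ≤ 2 * Real.log n := by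
    have := Nat.ceil_lt_add_one hlog0.le
    linarith
  refine ((h n).measure_not_isTameNoise_le (hf n) (k := k) hr0 (mul_pos hDpos hr0)
    (mul_pos hε hDpos) hlog hk0).trans (ENNReal.ofReal_le_ofReal ?_)
  have h3 : D / (D * Real.log n ^ δ) = 1 / Real.log n ^ δ := by field_simp
  rw [← hN, ← hDdef, h3]
  refine add_le_add le_rfl ?_
  have h4 : Real.log n * (D / Real.log n ^ 2 + (2 * k : ℕ)) ≤ Real.exp (-1) * (ε * D) := by
    have h5 : Real.log n * (D / Real.log n ^ 2) ≤ q * D := by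
      have : Real.log n * (D / Real.log n ^ 2) = D / Real.log n := by field_simp
      rw [this, div_le_iff₀ hlog0]
      have h6 : 1 ≤ q * Real.log n := by
        rw [div_le_iff₀ hq0] at hlogq
        linarith
      nlinarith
    have h7 : Real.log n * (2 * k : ℕ) ≤ 4 * (q * D) := by
      push_cast
      have h8 : Real.log n ^ 2 ≤ Real.log n ^ 4 := pow_le_pow_right₀ hlog (by norm_num)
      nlinarith
    have h9 : Real.exp (-1) * (ε * D) = 8 * (q * D) := by
      rw [hq, Real.exp_neg]
      field_simp
    rw [mul_add, h9]
    have := mul_pos hq0 hDpos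
    linarith
  have hn0' : (0 : ℝ) < n := by exact_mod_cast hn0
  calc (n : ℝ) * (Real.log n * (D / Real.log n ^ 2 + (2 * k : ℕ))) ^ (2 * k) / (ε * D) ^ (2 * k)
      ≤ n * (Real.exp (-1) * (ε * D)) ^ (2 * k) / (ε * D) ^ (2 * k) := by
        gcongr
    _ = n * Real.exp (-1) ^ (2 * k) := by
        have := mul_pos hε hDpos
        rw [mul_pow]
        field_simp
    _ ≤ n * Real.exp (-(2 * Real.log n)) := by
        rw [← Real.exp_nat_mul]
        gcongr
        push_cast
        linarith
    _ = 1 / n := by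
        rw [Real.exp_neg, two_mul, Real.exp_add, Real.exp_log hn0']
        field_simp

end HighProbability

/-! ### Perturbation bounds for the random matrix -/

section Perturbation

open Module

theorem topEigenvalue_eq_eigenvalues {n d k : ℕ} {M : Matrix (Fin n) (Fin n) ℝ}
    (hM : M.IsHermitian) (hk : d - k < n) (hn : finrank ℝ (EuclideanSpace ℝ (Fin n)) = n) :
    topEigenvalue d M k =
      (Matrix.isSymmetric_toEuclideanLin_iff.mpr hM).eigenvalues hn ⟨d - k, hk⟩ := by
  classical
  -- `eigenvalues₀` is indexed by the cardinality of `Fin n`; a variable dimension `N` allows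
  -- substitution.
  have key : ∀ (N : ℕ) (hN : finrank ℝ (EuclideanSpace ℝ (Fin n)) = N) (h : d - k < N),
      (Matrix.isSymmetric_toEuclideanLin_iff.mpr hM).eigenvalues hN ⟨d - k, h⟩ =
      (Matrix.isSymmetric_toEuclideanLin_iff.mpr hM).eigenvalues hn ⟨d - k, hk⟩ := by
    intro N hN h
    obtain rfl : n = N := hn.symm.trans hN
    rfl
  rw [topEigenvalue, dif_pos ⟨hM, hk⟩]
  convert! key _ finrank_euclideanSpace (by simpa using hk)

/-- The order of quantifiers is the point: the test vectors depend on `P` alone, so moment bounds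
for fixed vectors apply. The three families are the right and left singular vectors and the
eigenvectors of `P`. -/
theorem exists_test_vectors {n d : ℕ} (hdn : d < n) {P : Matrix (Fin n) (Fin n) ℝ}
    (hP : P.IsHermitian) :
    ∃ f : Fin 3 × Fin d → EuclideanSpace ℝ (Fin n), (∀ a, ‖f a‖ ≤ 1) ∧
      ∀ (A : Matrix (Fin n) (Fin n) ℝ) (t r η : ℝ), A.IsHermitian → 0 ≤ t → 0 ≤ r → 0 ≤ η →
        IsTameNoise f t r η (A - P) → ∀ k ∈ Finset.Icc 1 d,
        topSingularValue d P 0 + η < topSingularValue d P 1 →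
        |topSingularValue d A k - topSingularValue d P k| ≤
          d * t + d * r / (topSingularValue d P 1 - (topSingularValue d P 0 + η)) ∧
        topEigenvalue d P k - d * t ≤ topEigenvalue d A k ∧
        topEigenvalue d A k ≤ topSingularValue d A k := by
  have hn : finrank ℝ (EuclideanSpace ℝ (Fin n)) = n := by simp
  obtain ⟨u, w, huw⟩ := (Matrix.toEuclideanLin P).exists_svd hn
  have hPs := Matrix.isSymmetric_toEuclideanLin_iff.mpr hP
  set b := hPs.eigenvectorBasis hn with hb
  refine ⟨fun p => ![u, w, b] p.1 (Fin.castLE hdn.le p.2), ?_, ?_⟩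
  · rintro ⟨a, i⟩
    fin_cases a <;> simp
  intro A t r η hA ht hr hη hX k hk hgap
  obtain ⟨hk1, hkd⟩ := Finset.mem_Icc.1 hk
  have hAs := Matrix.isSymmetric_toEuclideanLin_iff.mpr hA
  obtain ⟨hX1, hX2, hX3⟩ := hX
  rw [map_sub] at hX1 hX2 hX3
  have hm : d - k < n := by omega
  have hmono : topSingularValue d P 1 ≤ topSingularValue d P k :=
    (Matrix.toEuclideanLin P).singularValues_antitone (by omega)
  refine ⟨?_, ?_, ?_⟩
  · have h1 : ∀ i j : Fin n, (i : ℕ) < d → (j : ℕ) < d →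
        |inner ℝ (w j) ((Matrix.toEuclideanLin A - Matrix.toEuclideanLin P) (u i))| ≤ t :=
      fun i j hi hj => hX1 (1, ⟨j, hj⟩) (0, ⟨i, hi⟩)
    have h2 : ∀ i : Fin n, (i : ℕ) < d →
        ‖(Matrix.toEuclideanLin A - Matrix.toEuclideanLin P) (u i)‖ ≤ √r :=
      fun i hi => Real.le_sqrt_of_sq_le (hX2 (0, ⟨i, hi⟩))
    have h3 : ∀ i : Fin n, (i : ℕ) < d →
        ‖(Matrix.toEuclideanLin A - Matrix.toEuclideanLin P) (w i)‖ ≤ √r :=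
      fun i hi => Real.le_sqrt_of_sq_le (hX2 (1, ⟨i, hi⟩))
    have hlow := singularValues_sub_le hn (Matrix.toEuclideanLin A) (Matrix.toEuclideanLin P) huw
      ht (m := ⟨d - k, hm⟩) (show d - k < d by omega) h1
    have hup := singularValues_le_add hn (Matrix.toEuclideanLin A) (Matrix.toEuclideanLin P)
      (hAs.sub hPs) huw ht (Real.sqrt_nonneg r) hη (m := ⟨d - k, hm⟩) h1 h2 h3 hX3
      (hgap.trans_le hmono)
    rw [Real.sq_sqrt hr] at hup
    change topSingularValue d P k - d * t ≤ topSingularValue d A k at hlow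
    change topSingularValue d A k ≤ topSingularValue d P k + d * t +
      d * r / (topSingularValue d P k - (topSingularValue d P 0 + η)) at hup
    have hpos : 0 < topSingularValue d P 1 - (topSingularValue d P 0 + η) := by linarith
    have hdiv : d * r / (topSingularValue d P k - (topSingularValue d P 0 + η)) ≤
        d * r / (topSingularValue d P 1 - (topSingularValue d P 0 + η)) := by
      gcongr
    have : 0 ≤ d * r / (topSingularValue d P 1 - (topSingularValue d P 0 + η)) := by positivity
    rw [abs_le]
    constructor <;> linarith
  · rw [topEigenvalue_eq_eigenvalues hP hm hn, topEigenvalue_eq_eigenvalues hA hm hn]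
    exact eigenvalues_sub_le hn hAs hPs ht (show d - k < d by omega)
      fun i j hi hj => hX1 (2, ⟨j, hj⟩) (2, ⟨i, hi⟩)
  · rw [topEigenvalue_eq_eigenvalues hA hm hn]
    exact eigenvalues_le_singularValues hn hAs ⟨d - k, hm⟩

theorem tendsto_measure_spectral_bounds {d : ℕ} (hd : 1 ≤ d) {C c δ : ℝ} (hcC : c < C) (hδ : 0 < δ)
    {P : ∀ n : ℕ, Matrix (Fin n) (Fin n) ℝ} (hP : HasSpikes d C c P)
    {Ω : ℕ → Type*} [∀ n, MeasurableSpace (Ω n)] {μ : ∀ n, Measure (Ω n)}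
    [∀ n, IsProbabilityMeasure (μ n)] {A : ∀ n, Ω n → Matrix (Fin n) (Fin n) ℝ}
    (h : ∀ n, IsIERM (μ n) (P n) (A n)) :
    Tendsto (fun n : ℕ => μ n {ω | ∀ k ∈ Finset.Icc 1 d,
      |topSingularValue d (A n ω) k - topSingularValue d (P n) k| ≤ Real.log n ^ δ ∧
      topEigenvalue d (P n) k - Real.log n ^ δ ≤ topEigenvalue d (A n ω) k ∧
      topEigenvalue d (A n ω) k ≤ topSingularValue d (A n ω) k}) atTop (𝓝 1) := by
  have hherm : ∀ n, (P n).IsHermitian := fun n => by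
    rw [Matrix.IsHermitian, Matrix.conjTranspose_eq_transpose_of_trivial]
    exact (h n).prob_symm
  have hf : ∀ n, ∃ f : Fin 3 × Fin d → EuclideanSpace ℝ (Fin n), (∀ a, ‖f a‖ ≤ 1) ∧
      (d < n → ∀ (A : Matrix (Fin n) (Fin n) ℝ) (t r η : ℝ), A.IsHermitian → 0 ≤ t → 0 ≤ r →
        0 ≤ η → IsTameNoise f t r η (A - P n) → ∀ k ∈ Finset.Icc 1 d,
        topSingularValue d (P n) 0 + η < topSingularValue d (P n) 1 →
        |topSingularValue d A k - topSingularValue d (P n) k| ≤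
          d * t + d * r / (topSingularValue d (P n) 1 - (topSingularValue d (P n) 0 + η)) ∧
        topEigenvalue d (P n) k - d * t ≤ topEigenvalue d A k ∧
        topEigenvalue d A k ≤ topSingularValue d A k) := by
    intro n
    by_cases hdn : d < n
    · obtain ⟨f, hf1, hf2⟩ := exists_test_vectors hdn (hherm n)
      exact ⟨f, hf1, fun _ => hf2⟩
    · exact ⟨0, by simp, fun h => absurd h hdn⟩
  choose f hf1 hf2 using hf
  -- Half of the gap `(C - c) * Δ` pays for the operator norm of the noise; the other half remains
  -- as the denominator.
  set ε := (C - c) / 2 with hε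
  have hε0 : 0 < ε := by rw [hε]; linarith
  -- Exponent `δ / 2` in the noise bounds: eventually `d + d / ε ≤ log ^ (δ / 2) n`, so the final
  -- constant does not depend on `C` and `c`.
  refine tendsto_measure_one_mono
    (tendsto_measure_isTameNoise hP.degree_growth h hf1 (half_pos hδ) hε0) ?_
  have hlogδ : Tendsto (fun n : ℕ => Real.log n ^ (δ / 2)) atTop atTop :=
    (tendsto_rpow_atTop (half_pos hδ)).comp tendsto_log_natCast
  filter_upwards [hP.signal, hP.noise, eventually_gt_atTop d, hP.degree_growth.def one_pos,
    hlogδ.eventually_ge_atTop (d + d / ε), tendsto_log_natCast.eventually_ge_atTop 1]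
    with n hsig hnoise hdn hgrow hL hlog ω hω k hk
  have hD := (h n).maxExpectedDegree_nonneg
  set D := maxExpectedDegree (P n) with hDdef
  have hlog0 : 0 < Real.log n := by linarith
  have hDpos : 0 < D := by
    rw [Real.norm_of_nonneg (by positivity), Real.norm_of_nonneg hD, one_mul] at hgrow
    have : 0 < Real.log n ^ 4 := by positivity
    linarith
  have hl : 0 < Real.log n ^ (δ / 2) := Real.rpow_pos_of_pos hlog0 _
  have hl2 : Real.log n ^ δ = Real.log n ^ (δ / 2) * Real.log n ^ (δ / 2) := by
    rw [← Real.rpow_add hlog0]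
    ring_nf
  have hgap : ε * D ≤
      topSingularValue d (P n) 1 - (topSingularValue d (P n) 0 + ε * D) := by
    have : C * D - c * D = 2 * (ε * D) := by rw [hε]; ring
    linarith
  have hεD : 0 < ε * D := by positivity
  have hAh : (A n ω).IsHermitian := by
    rw [Matrix.IsHermitian, Matrix.conjTranspose_eq_transpose_of_trivial]
    exact (h n).adj_symm ω
  obtain ⟨h1, h2, h3⟩ := hf2 n hdn (A n ω) _ _ _ hAh hl.le (by positivity) hεD.le hω k hk
    (by linarith)
  have h4 : d * (D * Real.log n ^ (δ / 2)) /
      (topSingularValue d (P n) 1 - (topSingularValue d (P n) 0 + ε * D)) ≤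
      d / ε * Real.log n ^ (δ / 2) := by
    calc _ ≤ d * (D * Real.log n ^ (δ / 2)) / (ε * D) := by gcongr
      _ = _ := by field_simp
  have h5 : (d + d / ε) * Real.log n ^ (δ / 2) ≤ Real.log n ^ δ := by
    rw [hl2]
    gcongr
  have h6 : 0 ≤ d / ε * Real.log n ^ (δ / 2) := by positivity
  refine ⟨?_, ?_, h3⟩ <;> linarith

end Perturbation

theorem sqrt_sum_abs_sq_le {d : ℕ} {a : ℕ → ℝ} {l : ℝ} (hl : 0 ≤ l)
    (h : ∀ k ∈ Finset.Icc 1 d, |a k| ≤ l) :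
    √(∑ k ∈ Finset.Icc 1 d, |a k| ^ 2) ≤ (d + 1) * l := by
  refine Real.sqrt_le_iff.2 ⟨by positivity, ?_⟩
  calc ∑ k ∈ Finset.Icc 1 d, |a k| ^ 2 ≤ ∑ _k ∈ Finset.Icc 1 d, l ^ 2 :=
        Finset.sum_le_sum fun k hk => pow_le_pow_left₀ (abs_nonneg _) (h k hk) 2
    _ = d * l ^ 2 := by simp
    _ ≤ ((d + 1) * l) ^ 2 := by
        rw [mul_pow]
        gcongr
        nlinarith [(Nat.cast_nonneg d : (0 : ℝ) ≤ d)]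

theorem theorem3p2 (d : ℕ) :
    -- individual bounds for the `d` largest singular values
    (∀ k : ℕ, 1 ≤ k → k ≤ d → ∃ K : ℝ, 0 < K ∧
      ∀ (C c δ : ℝ), 0 < c → c < C → 0 < δ → δ ≤ 1 →
      ∀ (P : ∀ n : ℕ, Matrix (Fin n) (Fin n) ℝ), HasSpikes d C c P →
      ∀ (Ω : ℕ → Type*) [∀ n, MeasurableSpace (Ω n)] (μ : ∀ n, Measure (Ω n))
        [∀ n, IsProbabilityMeasure (μ n)] (A : ∀ n, Ω n → Matrix (Fin n) (Fin n) ℝ),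
        (∀ n, IsIERM (μ n) (P n) (A n)) →
        Tendsto (fun n : ℕ => μ n {ω |
            |topSingularValue d (A n ω) k - topSingularValue d (P n) k| ≤ K * Real.log n ^ δ})
          atTop (𝓝 1)) ∧
    -- collective bounds, without any gap assumption within the `d` largest values
    (∃ K : ℝ, 0 < K ∧
      ∀ (C c : ℝ), 0 < c → c < C →
      ∀ (P : ∀ n : ℕ, Matrix (Fin n) (Fin n) ℝ), HasSpikes d C c P →
      ∀ (Ω : ℕ → Type*) [∀ n, MeasurableSpace (Ω n)] (μ : ∀ n, Measure (Ω n))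
        [∀ n, IsProbabilityMeasure (μ n)] (A : ∀ n, Ω n → Matrix (Fin n) (Fin n) ℝ),
        (∀ n, IsIERM (μ n) (P n) (A n)) →
        Tendsto (fun n : ℕ => μ n {ω |
            √(∑ k ∈ Finset.Icc 1 d,
                |topSingularValue d (A n ω) k - topSingularValue d (P n) k| ^ 2)
              ≤ K * Real.log n})
          atTop (𝓝 1) ∧
        -- if the `d` largest singular values of `P` are its `d` largest eigenvalues
        ((∀ᶠ n : ℕ in atTop, ∀ k ∈ Finset.Icc 1 d,
            topEigenvalue d (P n) k = topSingularValue d (P n) k) →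
          Tendsto (fun n : ℕ => μ n {ω |
              √(∑ k ∈ Finset.Icc 1 d,
                  |topEigenvalue d (A n ω) k - topEigenvalue d (P n) k| ^ 2)
                ≤ K * Real.log n})
            atTop (𝓝 1))) := by
  -- Individual bounds hold with constant `1`; the collective constant `d + 1` dominates `√d` and
  -- stays positive at `d = 0`.
  refine ⟨fun k hk1 hkd => ⟨1, one_pos, ?_⟩, d + 1, by positivity, ?_⟩
  · intro C c δ _ hcC hδ _ P hP Ω _ μ _ A h
    refine tendsto_measure_one_mono (tendsto_measure_spectral_bounds (hk1.trans hkd) hcC hδ hP h)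
      (Eventually.of_forall fun n ω hω => ?_)
    rw [Set.mem_ofPred_eq, one_mul]
    exact (hω k (Finset.mem_Icc.2 ⟨hk1, hkd⟩)).1
  · intro C c _ hcC P hP Ω _ μ _ A h
    rcases Nat.eq_zero_or_pos d with rfl | hd
    · have h0 : ∀ n : ℕ, 0 ≤ Real.log n := fun n => Real.log_natCast_nonneg n
      simp [h0]
    have key := tendsto_measure_spectral_bounds hd hcC one_pos hP h
    simp_rw [Real.rpow_one] at key
    refine ⟨tendsto_measure_one_mono key (Eventually.of_forall fun n ω hω => ?_), fun heig =>
      tendsto_measure_one_mono key ?_⟩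
    · exact sqrt_sum_abs_sq_le (Real.log_natCast_nonneg n) fun k hk => (hω k hk).1
    · filter_upwards [heig] with n hn ω hω
      refine sqrt_sum_abs_sq_le (Real.log_natCast_nonneg n) fun k hk => ?_
      obtain ⟨h1, h2, h3⟩ := hω k hk
      rw [abs_le] at h1 ⊢
      have h4 := hn k hk
      -- The upper estimate passes through `λ_k(A) ≤ σ_k(A) ≤ σ_k(P) + log n` and the hypothesis
      -- `σ_k(P) = λ_k(P)`.
      constructor <;> linarith
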